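/- Let $1\le k\le n$ be integers, let $f:\mathbb R\to(0,+\infty)$ be continuous and non-decreasing, and let $p>1$, $\beta<p-1$ and $-1<\alpha<\frac kn-1$. For $\lambda\in\mathbb R^n$ put $\Pi_k(\lambda)=\prod_{i_1<\cdots<i_k}(\lambda_{i_1}+\cdots+\lambda_{i_k})$ and $\mathcal P_k=\{\lambda\in\mathbb R^n:\lambda_{i_1}+\cdots+\lambda_{i_k}>0\text{ for all }i_1<\cdots<i_k\}$; for a matrix $A$ with real eigenvalues $\lambda(A)$ write $\Pi_k[A]=\Pi_k(\lambda(A))$. Consider the equation $$\Pi_k^{1/\binom nk}\big[D(|Du|^{p-2}Du)\big]=|x|^\alpha|Du|^\beta f(u)\quad\text{in }\mathbb R^n.\qquad(\ast)$$ An entire nontrivial admissible subsolution of $(\ast)$ is a non-constant function $u\in C^1(\mathbb R^n)\cap C^2(\mathbb R^n\setminus\{0\})$ such that at every $x\ne0$ the vector field $|Du|^{p-2}Du$ (taken to be $0$ where $Du=0$) is differentiable, $\lambda(D(|Du|^{p-2}Du))\in\mathcal P_k$, and $\Pi_k^{1/\binom nk}[D(|Du|^{p-2}Du)]\ge|x|^\alpha|Du|^\beta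 f(u)$. (Here $|Du|^\beta=+\infty$ if $\beta<0$ and $Du=0$, and $|Du|^0=1$; the origin is excluded because $|x|^\alpha$ is singular there.) (a) Suppose that for some $\epsilon\in\left(0,\frac{n(\alpha+1)}k\right)$, with $\kappa=\dfrac{1-\epsilon}{\frac{n(\alpha+1)}k-\epsilon}$, $$\int^{+\infty}\left(\int_0^t f^{\frac{\kappa n}k}(s)\,ds\right)^{-\frac1{\frac{\kappa n(p-\beta-1)}k+1}}dt=+\infty ,$$ the lower limit being any positive number. Then $(\ast)$ has an entire nontrivial admissible subsolution $u$, which moreover satisfies: (i) if $p\le\alpha+\beta+2$, then $u\in C^2(\mathbb R^n)$; (ii) if $p>\alpha+\beta+2$ and $(p-1)\alpha+\beta\ge0$, then $u\in W^{2,\delta}_{\rm loc}(\mathbb R^n)$ for every $\delta\in\left(1,\frac{p-\beta-1}{p-\alpha-\beta-2}\right)$. (b) Suppose that $(\ast)$ has an entire nontrivial admissible subsolution $u$ such that either $p\le\alpha+\beta+2$ and $u\in C^2(\mathbb R^n)$, or $p>\alpha+\beta+2$, $(p-1)\alpha+\beta\ge0$ and $u\in W^{2,\delta}_{\rm loc}(\mathbb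 R^n)$ for some $\delta\in\left(1,\frac{p-\beta-1}{p-\alpha-\beta-2}\right)$. Then $$\int^{+\infty}\left(\int_0^t f^{\frac nk}(s)\,ds\right)^{-\frac1{\frac{n(p-\beta-1)}k+1}}dt=+\infty .$$ -/

import Mathlib

open MeasureTheory Set
open scoped ContDiff Gradient

noncomputable section

namespace PiHessian

/-- The Euclidean space `ℝⁿ`. -/
abbrev Rn (n : ℕ) : Type := EuclideanSpace ℝ (Fin n)

/-- The vector field `|Du|^{p-2} Du`; at a zero of `Du` its value is `0`. -/
def pGradField {n : ℕ} (p : ℝ) (u : Rn n → ℝ) (x : Rn n) : Rn n :=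
  ‖∇ u x‖ ^ (p - 2) • ∇ u x

/-- `lam` lists the eigenvalues, with algebraic multiplicity, of the endomorphism `A` of `ℝⁿ`. -/
def IsEigenvalueTuple {n : ℕ} (A : Rn n →L[ℝ] Rn n) (lam : Fin n → ℝ) : Prop :=
  LinearMap.charpoly (A : Rn n →ₗ[ℝ] Rn n) = ∏ i, (Polynomial.X - Polynomial.C (lam i))

/-- The cone `𝒫_k`: all sums of `k` entries at distinct positions are positive. -/
def coneP (n k : ℕ) : Set (Fin n → ℝ) :=
  {lam | ∀ s ∈ Finset.powersetCard k (Finset.univ : Finset (Fin n)), 0 < ∑ i ∈ s, lam i}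

/-- `Π_k(λ)`, the product of all sums of `k` entries at distinct positions. -/
def PiK (n k : ℕ) (lam : Fin n → ℝ) : ℝ :=
  ∏ s ∈ Finset.powersetCard k (Finset.univ : Finset (Fin n)), ∑ i ∈ s, lam i

/-- At the point `x` the matrix `D(|Du|^{p-2}Du)` exists, its eigenvalues lie in `𝒫_k`
(admissibility), and `Π_k^{1/C(n,k)}[D(|Du|^{p-2}Du)] ≥ |x|^α |Du|^β f(u)`.
For `β < 0` the right side is infinite where `Du = 0`, so the inequality requires `Du ≠ 0`. -/
def AdmissibleSubsolutionAt (n k : ℕ) (p α β : ℝ) (f : ℝ → ℝ) (u : Rn n → ℝ) (x : Rn n) : Prop :=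
  DifferentiableAt ℝ (pGradField p u) x ∧
  (β < 0 → ∇ u x ≠ 0) ∧
  ∃ lam : Fin n → ℝ,
    IsEigenvalueTuple (fderiv ℝ (pGradField p u) x) lam ∧
    lam ∈ coneP n k ∧
    ‖x‖ ^ α * ‖∇ u x‖ ^ β * f (u x) ≤ PiK n k lam ^ (1 / (n.choose k : ℝ))

/-- Entire nontrivial admissible subsolution of
`Π_k^{1/C(n,k)}[D(|Du|^{p-2}Du)] = |x|^α |Du|^β f(u)`, for `α < 0`: `u` is `C¹` on `ℝⁿ`, `C²`
outside the origin and nonconstant, and is an admissible subsolution at every `x ≠ 0`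
(for `α < 0` the weight `|x|^α` has no value at the origin). -/
structure IsEntireSubsolution (n k : ℕ) (p α β : ℝ) (f : ℝ → ℝ) (u : Rn n → ℝ) : Prop where
  contDiff_one : ContDiff ℝ 1 u
  contDiffOn_two : ContDiffOn ℝ 2 u {0}ᶜ
  nontrivial : ∃ x y, u x ≠ u y
  subsolution : ∀ x, x ≠ 0 → AdmissibleSubsolutionAt n k p α β f u x

/-- `h ∈ L^δ_loc(ℝⁿ)`. -/
def LpLoc {n : ℕ} (δ : ℝ) (h : Rn n → ℝ) : Prop :=
  ∀ K : Set (Rn n), IsCompact K → MemLp h (ENNReal.ofReal δ) (volume.restrict K)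

/-- `h` is the weak `i`-th partial derivative of `w` on `ℝⁿ` (both locally integrable). -/
def IsWeakPartial {n : ℕ} (i : Fin n) (w h : Rn n → ℝ) : Prop :=
  LocallyIntegrable w volume ∧ LocallyIntegrable h volume ∧
  ∀ φ : Rn n → ℝ, ContDiff ℝ ∞ φ → HasCompactSupport φ →
    ∫ x, w x * fderiv ℝ φ x (EuclideanSpace.single i 1) = - ∫ x, h x * φ x

/-- `u ∈ W^{2,δ}_loc(ℝⁿ)`. -/
def SobolevW2Loc {n : ℕ} (δ : ℝ) (u : Rn n → ℝ) : Prop :=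
  LpLoc δ u ∧
  ∃ (g : Fin n → Rn n → ℝ) (h : Fin n → Fin n → Rn n → ℝ),
    (∀ i, LpLoc δ (g i) ∧ IsWeakPartial i u (g i)) ∧
    (∀ i j, LpLoc δ (h i j) ∧ IsWeakPartial j (g i) (h i j))

/-- The Keller–Osserman condition `∫^{+∞} (∫_0^t g(s) ds)^{-1/(θ+1)} dt = +∞`, the lower limit
being any positive number. -/
def KellerOsserman (g : ℝ → ℝ) (θ : ℝ) : Prop :=
  ∀ t₀ : ℝ, 0 < t₀ →
    ∫⁻ t in Ioi t₀, ENNReal.ofReal ((∫ s in (0 : ℝ)..t, g s) ^ (-(1 / (θ + 1)))) = ⊤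

end PiHessian

end

/-!
**Necessity.** If the Keller–Osserman integral converges, the solutions `φ` of
`(φ' ^ q)' = λ F(φ)`, with `F = f ^ (n / k)` and `q = n (p - β - 1) / k`, climb from any height to
infinity within a bounded time, whatever their initial slope. Let `T` be the inverse of `φ`. For a
suitable choice of the free constants, `T ∘ u - |x|` has an interior local maximum on an annulus far
from the origin. There `D²u` lies below an axially symmetric Hessian, so the eigenvalues of
`D(|Du|^{p-2} Du)` lie below a spike, a tuple with one distinguished entry and all others equal. As
`Π_k` is monotone on `𝒫_k` and explicit on spikes, the inequality for `u` becomes an inequality for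
`φ`, which fails because `|x| ^ (n (α + 1) / k)` grows with `|x|`.

**Existence.** The radial function `u = Y(|x| ^ m)` with `m = 1 + (α + 1) / (p - β - 1)` turns the
equation into the ordinary differential inequality solved by `Y`, which lives on `[0, ∞)` exactly
because the integral diverges. Jensen's inequality shows that divergence for `f ^ (κ n / k)` with
`κ ≥ 1` implies divergence for `f ^ (n / k)`. Since `D²u = O(|x| ^ (m - 2))` at the origin, `u` is
`C²` when `m ≥ 2`, and in `W^{2,δ}_loc` when `δ (2 - m) < n`.
-/

namespace PiHessian

open Filter Topology
open scoped RealInnerProductSpace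

/-! ### Spikes and the operator `Π_k` -/

section Spike

variable {ι : Type*} [DecidableEq ι]

/-- The tuple with entry `d₁` at `j` and entries `d₂` elsewhere: the eigenvalues of the Hessian of
a radial function. -/
def spike (j : ι) (d₁ d₂ : ℝ) : ι → ℝ :=
  Function.update (fun _ => d₂) j d₁

@[simp]
theorem spike_self (j : ι) (d₁ d₂ : ℝ) : spike j d₁ d₂ j = d₁ :=
  Function.update_self ..

theorem spike_of_ne {i j : ι} (h : i ≠ j) (d₁ d₂ : ℝ) : spike j d₁ d₂ i = d₂ :=
  Function.update_of_ne h ..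

theorem sum_spike_of_mem {j : ι} {s : Finset ι} (hj : j ∈ s) (d₁ d₂ : ℝ) :
    ∑ i ∈ s, spike j d₁ d₂ i = d₁ + ((s.card : ℝ) - 1) * d₂ := by
  rw [spike, Finset.sum_update_of_mem hj, Finset.sdiff_singleton_eq_erase, Finset.sum_const,
    nsmul_eq_mul, Finset.cast_card_erase_of_mem hj]

theorem sum_spike_of_notMem {j : ι} {s : Finset ι} (hj : j ∉ s) (d₁ d₂ : ℝ) :
    ∑ i ∈ s, spike j d₁ d₂ i = s.card * d₂ := by
  rw [spike, Finset.sum_update_of_notMem hj, Finset.sum_const, nsmul_eq_mul]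

theorem card_filter_notMem_powersetCard {j : ι} {s : Finset ι} (hj : j ∈ s) (k : ℕ) :
    ((s.powersetCard k).filter (j ∉ ·)).card = (s.card - 1).choose k := by
  have h : (s.powersetCard k).filter (j ∉ ·) = (s.erase j).powersetCard k := by
    ext t
    simp only [Finset.mem_filter, Finset.mem_powersetCard, Finset.subset_erase]
    tauto
  rw [h, Finset.card_powersetCard, Finset.card_erase_of_mem hj]

theorem card_filter_mem_powersetCard {j : ι} {s : Finset ι} (hj : j ∈ s) {k : ℕ} (hk : 1 ≤ k) :
    ((s.powersetCard k).filter (j ∈ ·)).card = (s.card - 1).choose (k - 1) := by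
  have hsplit := Finset.card_filter_add_card_filter_not (s := s.powersetCard k) (j ∈ ·)
  have hs : 0 < s.card := Finset.card_pos.2 ⟨j, hj⟩
  rw [card_filter_notMem_powersetCard hj, Finset.card_powersetCard,
    Nat.choose_eq_choose_pred_add hs hk] at hsplit
  omega

end Spike

theorem choose_pred_pred_div_choose {n k : ℕ} (hk : 1 ≤ k) (hkn : k ≤ n) :
    ((n - 1).choose (k - 1) : ℝ) / n.choose k = k / n := by
  obtain ⟨k, rfl⟩ := Nat.exists_eq_add_of_le' hk
  obtain ⟨n, rfl⟩ := Nat.exists_eq_add_of_le' (hk.trans hkn)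
  have hpos : 0 < (n + 1).choose (k + 1) := Nat.choose_pos hkn
  rw [div_eq_div_iff (by positivity) (by positivity)]
  exact_mod_cast ((mul_comm _ _).trans (Nat.add_one_mul_choose_eq n k)).trans (mul_comm _ _)

theorem choose_pred_div_choose {n k : ℕ} (hk : 1 ≤ k) (hkn : k ≤ n) :
    ((n - 1).choose k : ℝ) / n.choose k = (n - k) / n := by
  have hn : (n : ℝ) ≠ 0 := Nat.cast_ne_zero.2 (Nat.one_le_iff_ne_zero.1 (hk.trans hkn))
  have hpos : (n.choose k : ℝ) ≠ 0 := by exact_mod_cast (Nat.choose_pos hkn).ne'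
  have hpascal : (n.choose k : ℝ) = (n - 1).choose (k - 1) + (n - 1).choose k := by
    exact_mod_cast Nat.choose_eq_choose_pred_add (hk.trans hkn) hk
  rw [sub_div, div_self hn, ← choose_pred_pred_div_choose hk hkn, eq_sub_iff_add_eq', ← add_div,
    ← hpascal, div_self hpos]

section ConeP

variable {n k : ℕ} {lam μ : Fin n → ℝ}

theorem PiK_pos (h : lam ∈ coneP n k) : 0 < PiK n k lam :=
  Finset.prod_pos h

theorem PiK_mono (h : lam ∈ coneP n k) (hle : lam ≤ μ) : PiK n k lam ≤ PiK n k μ :=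
  Finset.prod_le_prod (fun s hs => (h s hs).le) fun _ _ => Finset.sum_le_sum fun i _ => hle i

theorem isUpperSet_coneP : IsUpperSet (coneP n k) :=
  fun _ _ hle h s hs => (h s hs).trans_le (Finset.sum_le_sum fun i _ => hle i)

theorem exists_pos_of_mem_coneP (hkn : k ≤ n) (h : lam ∈ coneP n k) : ∃ i, 0 < lam i := by
  obtain ⟨s, hs⟩ := Finset.powersetCard_nonempty.2 (hkn.trans_eq (Finset.card_fin n).symm)
  obtain ⟨i, -, hi⟩ := Finset.exists_lt_of_sum_lt (f := fun _ => (0 : ℝ)) (by simpa using h s hs)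
  exact ⟨i, hi⟩

variable {j : Fin n} {d₁ d₂ : ℝ}

theorem spike_mem_coneP (hk : 1 ≤ k) (h₁ : 0 < d₁ + ((k : ℝ) - 1) * d₂) (h₂ : 0 < d₂) :
    spike j d₁ d₂ ∈ coneP n k := by
  intro s hs
  have hcard := (Finset.mem_powersetCard.1 hs).2
  by_cases hj : j ∈ s
  · rwa [sum_spike_of_mem hj, hcard]
  · rw [sum_spike_of_notMem hj, hcard]
    positivity

theorem pos_of_spike_mem_coneP (hk : 1 ≤ k) (hkn : k ≤ n) (h : spike j d₁ d₂ ∈ coneP n k) :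
    0 < d₁ + ((k : ℝ) - 1) * d₂ := by
  obtain ⟨s, hjs, -, hcard⟩ := Finset.exists_subsuperset_card_eq (Finset.subset_univ {j})
    (by simpa using hk) (by simpa using hkn)
  have hsum := h s (Finset.mem_powersetCard.2 ⟨s.subset_univ, hcard⟩)
  rwa [sum_spike_of_mem (Finset.singleton_subset_iff.1 hjs), hcard] at hsum

theorem spike_notMem_coneP (hk : 1 ≤ k) (hkn : k ≤ n) (h₁ : d₁ ≤ 0) (h₂ : d₂ ≤ 0) :
    spike j d₁ d₂ ∉ coneP n k := by
  intro h
  have hk' : (1 : ℝ) ≤ k := by exact_mod_cast hk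
  nlinarith [pos_of_spike_mem_coneP hk hkn h]

theorem PiK_spike (hk : 1 ≤ k) (j : Fin n) (d₁ d₂ : ℝ) :
    PiK n k (spike j d₁ d₂) =
      (d₁ + ((k : ℝ) - 1) * d₂) ^ (n - 1).choose (k - 1) * (k * d₂) ^ (n - 1).choose k := by
  have hmem := card_filter_mem_powersetCard (Finset.mem_univ j) hk
  have hnot := card_filter_notMem_powersetCard (Finset.mem_univ j) k
  rw [Finset.card_fin] at hmem hnot
  rw [PiK, ← Finset.prod_filter_mul_prod_filter_not _ (j ∈ ·), ← hmem, ← hnot]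
  congr 1 <;> refine Finset.prod_eq_pow_card fun s hs => ?_ <;>
    rw [Finset.mem_filter, Finset.mem_powersetCard] at hs
  · rw [sum_spike_of_mem hs.2, hs.1.2]
  · rw [sum_spike_of_notMem hs.2, hs.1.2]

theorem PiK_spike_rpow (hk : 1 ≤ k) (hkn : k ≤ n) (h₁ : 0 < d₁ + ((k : ℝ) - 1) * d₂)
    (h₂ : 0 < d₂) :
    PiK n k (spike j d₁ d₂) ^ (1 / (n.choose k : ℝ)) =
      (d₁ + ((k : ℝ) - 1) * d₂) ^ ((k : ℝ) / n) * (k * d₂) ^ (((n : ℝ) - k) / n) := by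
  rw [PiK_spike hk, Real.mul_rpow (by positivity) (by positivity), ← Real.rpow_natCast_mul h₁.le,
    ← Real.rpow_natCast_mul (by positivity), mul_one_div, mul_one_div,
    choose_pred_pred_div_choose hk hkn, choose_pred_div_choose hk hkn]

end ConeP

/-! ### Eigenvalues of symmetric operators below an axially symmetric one -/

section Axial

variable {E : Type*} [NormedAddCommGroup E] [InnerProductSpace ℝ E]

/-- For a unit vector `ν`, the operator `d₁ ν ⊗ ν + d₂ (I - ν ⊗ ν)`: it multiplies `ν` by `d₁` and
the orthogonal complement of `ν` by `d₂`. -/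
noncomputable def axial (ν : E) (d₁ d₂ : ℝ) : E →L[ℝ] E :=
  d₂ • ContinuousLinearMap.id ℝ E + (d₁ - d₂) • (innerSL ℝ ν).smulRight ν

theorem axial_apply (ν : E) (d₁ d₂ : ℝ) (h : E) :
    axial ν d₁ d₂ h = d₂ • h + ((d₁ - d₂) * ⟪ν, h⟫) • ν := by
  simp [axial, smul_smul]

theorem axial_comp_axial {ν : E} (hν : ‖ν‖ = 1) (d₁ d₂ e₁ e₂ : ℝ) :
    axial ν d₁ d₂ ∘L axial ν e₁ e₂ = axial ν (d₁ * e₁) (d₂ * e₂) := by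
  ext h
  simp only [ContinuousLinearMap.comp_apply, axial_apply, inner_add_right, inner_smul_right,
    real_inner_self_eq_norm_sq, hν]
  module

theorem inner_axial_left (ν : E) (d₁ d₂ : ℝ) (v w : E) :
    ⟪axial ν d₁ d₂ v, w⟫ = ⟪v, axial ν d₁ d₂ w⟫ := by
  simp only [axial_apply, inner_add_left, inner_add_right, real_inner_smul_left,
    real_inner_smul_right, real_inner_comm v ν]
  ring

theorem inner_axial_self (ν : E) (d₁ d₂ : ℝ) (h : E) :
    ⟪axial ν d₁ d₂ h, h⟫ = d₁ * ⟪ν, h⟫ ^ 2 + d₂ * (‖h‖ ^ 2 - ⟪ν, h⟫ ^ 2) := by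
  rw [axial_apply, inner_add_left, real_inner_smul_left, real_inner_smul_left,
    real_inner_self_eq_norm_sq]
  ring

theorem inner_axial_axial {ν : E} (hν : ‖ν‖ = 1) (d₁ d₂ e₁ e₂ : ℝ) (h : E) :
    ⟪axial ν d₁ d₂ (axial ν e₁ e₂ h), axial ν e₁ e₂ h⟫ =
      ⟪axial ν (e₁ ^ 2 * d₁) (e₂ ^ 2 * d₂) h, h⟫ := by
  rw [← inner_axial_left, ← ContinuousLinearMap.comp_apply, ← ContinuousLinearMap.comp_apply,
    axial_comp_axial hν, axial_comp_axial hν]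
  ring_nf

theorem axial_normalize_smul {ν : E} (hν : ‖ν‖ = 1) {c : ℝ} (hc : c ≠ 0) (d₁ d₂ : ℝ) :
    axial (‖c • ν‖⁻¹ • c • ν) d₁ d₂ = axial ν d₁ d₂ := by
  have hsq : (|c|⁻¹ * c) * (|c|⁻¹ * c) = 1 := by
    rw [mul_mul_mul_comm, ← abs_mul_abs_self c]
    field_simp
  ext h
  rw [norm_smul, hν, mul_one, Real.norm_eq_abs, smul_smul, axial_apply, axial_apply,
    real_inner_smul_left, smul_smul]
  congr 2
  linear_combination (d₁ - d₂) * ⟪ν, h⟫ * hsq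

end Axial

section Eigenbasis

variable {ι E : Type*} [Fintype ι] [NormedAddCommGroup E] [InnerProductSpace ℝ E]
  {N : E →ₗ[ℝ] E} {b : OrthonormalBasis ι ℝ E} {lam : ι → ℝ} {ν : E} {d₁ d₂ : ℝ}

theorem inner_apply_self_eq_sum (hb : ∀ i, N (b i) = lam i • b i) (h : E) :
    ⟪N h, h⟫ = ∑ i, lam i * ⟪b i, h⟫ ^ 2 := by
  conv_lhs => enter [2, 2]; rw [← b.sum_repr' h]
  rw [map_sum, sum_inner]
  refine Finset.sum_congr rfl fun i _ => ?_
  rw [map_smul, hb, real_inner_smul_left, real_inner_smul_left]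
  ring

theorem eigenvalue_le_max (hb : ∀ i, N (b i) = lam i • b i) (hν : ‖ν‖ = 1)
    (hle : ∀ h, ⟪N h, h⟫ ≤ ⟪axial ν d₁ d₂ h, h⟫) (i : ι) : lam i ≤ max d₁ d₂ := by
  have hbi : ‖b i‖ = 1 := b.orthonormal.1 i
  have hinner : ⟪ν, b i⟫ ^ 2 ≤ 1 := by
    simpa [hν, hbi, sq_le_one_iff_abs_le_one] using abs_real_inner_le_norm ν (b i)
  have h := hle (b i)
  rw [hb, inner_axial_self, real_inner_smul_left, real_inner_self_eq_norm_sq, hbi] at h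
  nlinarith [le_max_left d₁ d₂, le_max_right d₁ d₂, sq_nonneg ⟪ν, b i⟫]

theorem exists_eigenvalue_le (hb : ∀ i, N (b i) = lam i • b i) (hν : ‖ν‖ = 1)
    (hle : ⟪N ν, ν⟫ ≤ d₁) : ∃ j, lam j ≤ d₁ := by
  have hsum : ∑ i, ⟪b i, ν⟫ ^ 2 = 1 := by simpa [hν] using b.sum_sq_norm_inner_right ν
  have hle' : ∑ i, lam i * ⟪b i, ν⟫ ^ 2 ≤ ∑ i, d₁ * ⟪b i, ν⟫ ^ 2 := by
    rwa [← Finset.mul_sum, hsum, mul_one, ← inner_apply_self_eq_sum hb]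
  by_contra! hlt
  obtain ⟨i, -, hi⟩ : ∃ i ∈ Finset.univ, (0 : ℝ) < ⟪b i, ν⟫ ^ 2 :=
    Finset.exists_lt_of_sum_lt (by simp [hsum])
  exact hle'.not_gt (Finset.sum_lt_sum (fun i _ => by gcongr; exact (hlt i).le)
    ⟨i, Finset.mem_univ i, by gcongr; exact hlt i⟩)

-- The plane spanned by two eigenvectors contains a nonzero vector orthogonal to `ν`.
theorem eigenvalue_le_or_eigenvalue_le (hb : ∀ i, N (b i) = lam i • b i)
    (hle : ∀ h, ⟪ν, h⟫ = 0 → ⟪N h, h⟫ ≤ d₂ * ‖h‖ ^ 2) {i j : ι} (hij : i ≠ j) :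
    lam i ≤ d₂ ∨ lam j ≤ d₂ := by
  obtain ⟨x, y, hxy, hν⟩ : ∃ x y : ℝ, 0 < x ^ 2 + y ^ 2 ∧ ⟪ν, x • b i + y • b j⟫ = 0 := by
    simp only [inner_add_right, real_inner_smul_right]
    by_cases h : ⟪ν, b i⟫ = 0
    · exact ⟨1, 0, by norm_num, by simp [h]⟩
    · exact ⟨⟪ν, b j⟫, -⟪ν, b i⟫,
        add_pos_of_nonneg_of_pos (sq_nonneg _) (sq_pos_of_ne_zero (neg_ne_zero.2 h)), by ring⟩
  have horth : ⟪b i, b j⟫ = 0 := b.orthonormal.2 hij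
  have hbi : ⟪b i, b i⟫ = 1 := by simp
  have hbj : ⟪b j, b j⟫ = 1 := by simp
  have h := hle _ hν
  simp only [← real_inner_self_eq_norm_sq, map_add, map_smul, hb, inner_add_left, inner_add_right,
    real_inner_smul_left, real_inner_smul_right, real_inner_comm (b i) (b j), horth, hbi, hbj] at h
  by_contra! hlt
  rcases (sq_nonneg x).eq_or_lt with hx | hx <;> nlinarith [hlt.1, hlt.2, sq_nonneg y]

theorem exists_le_spike_of_eigenbasis [DecidableEq ι] (hb : ∀ i, N (b i) = lam i • b i)
    (hν : ‖ν‖ = 1) (hle : ∀ h, ⟪N h, h⟫ ≤ ⟪axial ν d₁ d₂ h, h⟫) :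
    ∃ j, lam ≤ spike j d₁ d₂ := by
  suffices ∃ j, lam j ≤ d₁ ∧ ∀ i, i ≠ j → lam i ≤ d₂ by
    obtain ⟨j, hj, hne⟩ := this
    refine ⟨j, fun i => ?_⟩
    rcases eq_or_ne i j with rfl | hij
    · rwa [spike_self]
    · rw [spike_of_ne hij]
      exact hne i hij
  by_cases hall : ∀ i, lam i ≤ d₂
  · obtain ⟨j, hj⟩ : ∃ j, lam j ≤ d₁ :=
      exists_eigenvalue_le hb hν (by simpa [inner_axial_self, hν] using hle ν)
    exact ⟨j, hj, fun i _ => hall i⟩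
  · obtain ⟨j, hj⟩ := not_forall.1 hall
    refine ⟨j, (le_max_iff.1 (eigenvalue_le_max hb hν hle j)).resolve_right hj, fun i hij => ?_⟩
    refine (eigenvalue_le_or_eigenvalue_le (ν := ν) hb (fun h hh => ?_) hij).resolve_right hj
    simpa [inner_axial_self, hh] using hle h

end Eigenbasis

theorem exists_perm_of_map_univ_eq {ι γ : Type*} [Fintype ι] {f g : ι → γ}
    (h : Multiset.map f Finset.univ.val = Multiset.map g Finset.univ.val) :
    ∃ σ : Equiv.Perm ι, f ∘ σ = g := by
  classical
  have hfiber : ∀ c, Nonempty ({a // g a = c} ≃ {a // f a = c}) := fun c => by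
    have hcount := congrArg (Multiset.count c) h
    rw [Multiset.count_map, Multiset.count_map] at hcount
    rw [← Fintype.card_eq, Fintype.card_subtype, Fintype.card_subtype]
    simpa [Finset.card, Finset.filter_val, eq_comm] using hcount.symm
  exact ⟨Equiv.ofFiberEquiv fun c => (hfiber c).some,
    funext fun a => Equiv.ofFiberEquiv_map (fun c => (hfiber c).some) a⟩

theorem exists_eigenbasis_of_charpoly_eq {E : Type*} [NormedAddCommGroup E]
    [InnerProductSpace ℝ E] [FiniteDimensional ℝ E] {n : ℕ} (hn : Module.finrank ℝ E = n)
    {N : E →ₗ[ℝ] E} (hN : N.IsSymmetric) {lam : Fin n → ℝ}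
    (hlam : N.charpoly = ∏ i, (Polynomial.X - Polynomial.C (lam i))) :
    ∃ b : OrthonormalBasis (Fin n) ℝ E, ∀ i, N (b i) = lam i • b i := by
  have hroots : N.charpoly.roots = Multiset.map lam Finset.univ.val := by
    rw [hlam, ← Polynomial.roots_multiset_prod_X_sub_C (Multiset.map lam Finset.univ.val),
      Multiset.map_map]
    rfl
  obtain ⟨σ, hσ⟩ := exists_perm_of_map_univ_eq
    ((hN.roots_charpoly_eq_eigenvalues hn).symm.trans hroots)
  refine ⟨(hN.eigenvectorBasis hn).reindex σ.symm, fun i => ?_⟩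
  rw [OrthonormalBasis.reindex_apply, Equiv.symm_symm, hN.apply_eigenvectorBasis, ← hσ]
  rfl

theorem charpoly_comp_comm {R M : Type*} [CommRing R] [AddCommGroup M] [Module R M]
    [Module.Free R M] [Module.Finite R M] (A B : M →ₗ[R] M) :
    (A ∘ₗ B).charpoly = (B ∘ₗ A).charpoly := by
  classical
  let b := Module.Free.chooseBasis R M
  rw [← LinearMap.charpoly_toMatrix _ b, ← LinearMap.charpoly_toMatrix _ b,
    LinearMap.toMatrix_comp b b b, LinearMap.toMatrix_comp b b b, Matrix.charpoly_mul_comm]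

theorem isEigenvalueTuple_axial {n : ℕ} {ν : Rn n} (hν : ‖ν‖ = 1) (j : Fin n) (d₁ d₂ : ℝ) :
    IsEigenvalueTuple (axial ν d₁ d₂) (spike j d₁ d₂) := by
  have hsingle : Orthonormal ℝ (({j} : Set (Fin n)).domRestrict fun _ => ν) :=
    ⟨fun _ => hν, fun i i' h => absurd (Subsingleton.elim i i') h⟩
  obtain ⟨b, hb⟩ := hsingle.exists_orthonormalBasis_extension_of_card_eq (by simp)
  have hbj : b j = ν := hb j rfl
  have hdiag : LinearMap.toMatrix b.toBasis b.toBasis (axial ν d₁ d₂ : Rn n →ₗ[ℝ] Rn n) =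
      Matrix.diagonal (spike j d₁ d₂) := by
    ext i i'
    rw [LinearMap.toMatrix_apply, Matrix.diagonal_apply]
    simp only [OrthonormalBasis.coe_toBasis, OrthonormalBasis.coe_toBasis_repr_apply,
      ContinuousLinearMap.coe_coe, OrthonormalBasis.repr_apply_apply, axial_apply, ← hbj,
      inner_add_right, inner_smul_right, b.inner_eq_ite]
    rcases eq_or_ne i j with rfl | hi
    · rcases eq_or_ne i i' with rfl | hii' <;> simp [*]
    · simp [spike_of_ne hi, hi]
  rw [IsEigenvalueTuple, ← LinearMap.charpoly_toMatrix _ b.toBasis, hdiag,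
    Matrix.charpoly_diagonal]

/-! ### The derivative of `|Du|^{p-2} Du` -/

section NormRpow

variable {E : Type*} [NormedAddCommGroup E] [InnerProductSpace ℝ E] {y : E}

theorem hasFDerivAt_norm_rpow_of_ne_zero (q : ℝ) (hy : y ≠ 0) :
    HasFDerivAt (fun z : E => ‖z‖ ^ q) ((q * ‖y‖ ^ (q - 2)) • innerSL ℝ y) y := by
  have hsq := (hasStrictFDerivAt_norm_sq y).hasFDerivAt.rpow_const (p := q / 2) (by simp [hy])
  have hfun : (fun z : E => ‖z‖ ^ q) = fun z => (‖z‖ ^ 2) ^ (q / 2) := by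
    ext z
    rw [← Real.rpow_natCast_mul (norm_nonneg z), Nat.cast_ofNat, mul_div_cancel₀ _ two_ne_zero]
  rw [hfun]
  refine hsq.congr_fderiv ?_
  rw [← Real.rpow_natCast_mul (norm_nonneg y), ← Nat.cast_smul_eq_nsmul ℝ, smul_smul]
  push_cast
  ring_nf

theorem hasFDerivAt_norm_rpow_smul (p : ℝ) (hy : y ≠ 0) :
    HasFDerivAt (fun z : E => ‖z‖ ^ (p - 2) • z)
      (axial (‖y‖⁻¹ • y) ((p - 1) * ‖y‖ ^ (p - 2)) (‖y‖ ^ (p - 2))) y := by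
  have hpow : ‖y‖ ^ (p - 2 - 2) = ‖y‖ ^ (p - 2) * (‖y‖⁻¹ * ‖y‖⁻¹) := by
    rw [Real.rpow_sub (norm_pos_iff.2 hy), Real.rpow_two, sq, div_eq_mul_inv, mul_inv]
  refine ((hasFDerivAt_norm_rpow_of_ne_zero (p - 2) hy).smul (hasFDerivAt_id y)).congr_fderiv ?_
  ext1 h
  simp only [axial_apply, add_apply, smul_apply, ContinuousLinearMap.smulRight_apply,
    innerSL_apply_apply, real_inner_smul_left, hpow, id, ContinuousLinearMap.id_apply, smul_eq_mul]
  module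

end NormRpow

section PGradField

variable {n : ℕ} {p : ℝ} {u : Rn n → ℝ} {x ν : Rn n} {H : Rn n →L[ℝ] Rn n} {c : ℝ}

theorem hasFDerivAt_pGradField (hH : HasFDerivAt (∇ u) H x) (hν : ‖ν‖ = 1) (hc : c ≠ 0)
    (hgrad : ∇ u x = c • ν) :
    HasFDerivAt (pGradField p u)
      (axial ν ((p - 1) * |c| ^ (p - 2)) (|c| ^ (p - 2)) ∘L H) x := by
  have hnorm : ‖c • ν‖ = |c| := by rw [norm_smul, hν, mul_one, Real.norm_eq_abs]
  have hne : ∇ u x ≠ 0 := by rwa [hgrad, ← norm_ne_zero_iff, hnorm, abs_ne_zero]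
  have h := (hasFDerivAt_norm_rpow_smul p hne).comp x hH
  rwa [hgrad, axial_normalize_smul hν hc, hnorm] at h

-- With `Q ∘ Q` the axial factor, `Q ∘ Q ∘ H` is cospectral to the symmetric operator `Q ∘ H ∘ Q`.
theorem exists_le_spike_of_hessian_le (hp : 1 < p) (hH : HasFDerivAt (∇ u) H x)
    (hsymm : (H : Rn n →ₗ[ℝ] Rn n).IsSymmetric) (hν : ‖ν‖ = 1) (hc : c ≠ 0)
    (hgrad : ∇ u x = c • ν) {e₁ e₂ : ℝ} (hle : ∀ h, ⟪H h, h⟫ ≤ ⟪axial ν e₁ e₂ h, h⟫)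
    {lam : Fin n → ℝ} (hlam : IsEigenvalueTuple (fderiv ℝ (pGradField p u) x) lam) :
    ∃ j, lam ≤ spike j ((p - 1) * |c| ^ (p - 2) * e₁) (|c| ^ (p - 2) * e₂) := by
  set d₁ : ℝ := (p - 1) * |c| ^ (p - 2)
  set d₂ : ℝ := |c| ^ (p - 2)
  have hd₁ : √d₁ ^ 2 = d₁ :=
    Real.sq_sqrt (mul_nonneg (sub_nonneg.2 hp.le) (Real.rpow_nonneg (abs_nonneg c) _))
  have hd₂ : √d₂ ^ 2 = d₂ := Real.sq_sqrt (Real.rpow_nonneg (abs_nonneg c) _)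
  set Q : Rn n →L[ℝ] Rn n := axial ν √d₁ √d₂ with hQ
  have hQQ : axial ν d₁ d₂ = Q ∘L Q := by rw [hQ, axial_comp_axial hν, ← sq, ← sq, hd₁, hd₂]
  have hQHQ : ((Q ∘L H ∘L Q : Rn n →L[ℝ] Rn n) : Rn n →ₗ[ℝ] Rn n).IsSymmetric := fun v w =>
    (inner_axial_left ..).trans ((hsymm _ _).trans (inner_axial_left ..))
  have hcharpoly : ((Q ∘L H ∘L Q : Rn n →L[ℝ] Rn n) : Rn n →ₗ[ℝ] Rn n).charpoly =
      ∏ i, (Polynomial.X - Polynomial.C (lam i)) := by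
    rw [← hlam, (hasFDerivAt_pGradField hH hν hc hgrad).fderiv, hQQ]
    simp only [ContinuousLinearMap.toLinearMap_comp, ← LinearMap.comp_assoc]
    rw [charpoly_comp_comm, ← LinearMap.comp_assoc]
  obtain ⟨b, hb⟩ := exists_eigenbasis_of_charpoly_eq finrank_euclideanSpace_fin hQHQ hcharpoly
  refine exists_le_spike_of_eigenbasis hb hν fun h => ?_
  calc ⟪Q (H (Q h)), h⟫ = ⟪H (Q h), Q h⟫ := inner_axial_left ..
    _ ≤ ⟪axial ν e₁ e₂ (Q h), Q h⟫ := hle _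
    _ = ⟪axial ν (d₁ * e₁) (d₂ * e₂) h, h⟫ := by rw [inner_axial_axial hν, hd₁, hd₂]

end PGradField

/-! ### Necessary conditions at a local maximum -/

theorem not_isLocalMax_of_deriv_pos_right {g g' : ℝ → ℝ} {a : ℝ}
    (hg : ∀ᶠ t in 𝓝 a, HasDerivAt g (g' t) t) (hpos : ∀ᶠ t in 𝓝[>] a, 0 < g' t) :
    ¬ IsLocalMax g a := by
  intro hmax
  obtain ⟨ε, hε, h⟩ := Metric.eventually_nhds_iff.1
    (hg.and (hmax.and (eventually_nhdsWithin_iff.1 hpos)))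
  have hnear : ∀ t ∈ Icc a (a + ε / 2), dist t a < ε := fun t ht => by
    rw [Real.dist_eq, abs_of_nonneg (sub_nonneg.2 ht.1)]
    linarith [ht.2]
  obtain ⟨t, ht, hslope⟩ := exists_hasDerivAt_eq_slope g g' (by linarith : a < a + ε / 2)
    (fun t ht => (h (hnear t ht)).1.continuousAt.continuousWithinAt)
    fun t ht => (h (hnear t (Ioo_subset_Icc_self ht))).1
  have hle : g (a + ε / 2) ≤ g a := (h (hnear _ (right_mem_Icc.2 (by linarith)))).2.1
  have hpos_t : 0 < g' t := (h (hnear t (Ioo_subset_Icc_self ht))).2.2 ht.1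
  rw [hslope, div_pos_iff_of_pos_right (by linarith)] at hpos_t
  linarith

theorem eventually_pos_of_hasDerivAt_pos {g : ℝ → ℝ} {a c : ℝ} (hg : HasDerivAt g c a)
    (ha : g a = 0) (hc : 0 < c) : ∀ᶠ t in 𝓝[>] a, 0 < g t := by
  have hsign := eventually_nhdsWithin_sign_eq_of_deriv_pos (hg.deriv.symm ▸ hc) ha
  filter_upwards [hsign.filter_mono nhdsWithin_le_nhds, self_mem_nhdsWithin] with t ht hat
  rwa [sign_pos (sub_pos.2 hat), sign_eq_one_iff] at ht

section LocalMax

variable {E : Type*} [NormedAddCommGroup E] [InnerProductSpace ℝ E] {x : E}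

theorem hasDerivAt_add_smul (x h : E) (t : ℝ) : HasDerivAt (fun t : ℝ => x + t • h) h t := by
  simpa using ((hasDerivAt_id t).smul_const h).const_add x

theorem tendsto_add_smul_zero (x h : E) : Tendsto (fun t : ℝ => x + t • h) (𝓝 0) (𝓝 x) := by
  simpa using (hasDerivAt_add_smul x h 0).continuousAt.tendsto

theorem eventually_inner_pos {W : E → E} {S : E →L[ℝ] E} {e : E} (hW : HasFDerivAt W S x)
    (hx : W x = 0) (he : 0 < ⟪S e, e⟫) : ∀ᶠ t in 𝓝[>] (0 : ℝ), 0 < ⟪W (x + t • e), e⟫ := by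
  have hline : HasDerivAt (fun t : ℝ => W (x + t • e)) (S e) 0 :=
    HasFDerivAt.comp_hasDerivAt (l := W) 0 (by simpa using hW) (hasDerivAt_add_smul x e 0)
  refine eventually_pos_of_hasDerivAt_pos (c := ⟪S e, e⟫) ?_ (by simp [hx]) he
  simpa using hline.inner ℝ (hasDerivAt_const (0 : ℝ) e)

variable {Φ : E → ℝ}

theorem not_isLocalMax_add_norm_zero [Nontrivial E] (hΦ : DifferentiableAt ℝ Φ 0) {ε : ℝ}
    (hε : 0 < ε) : ¬ IsLocalMax (fun y => Φ y + ε * ‖y‖) 0 := by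
  intro hmax
  have hle : ∀ᶠ y in 𝓝 (0 : E), Φ y + ε * ‖y‖ ≤ Φ 0 := by
    simpa [IsLocalMax, IsMaxFilter] using hmax
  have hzero : fderiv ℝ Φ 0 = 0 := IsLocalMax.fderiv_eq_zero <| by
    filter_upwards [hle] with y hy
    linarith [mul_nonneg hε.le (norm_nonneg y)]
  have hlittle : ∀ᶠ y in 𝓝 (0 : E), ‖Φ y - Φ 0‖ ≤ ε / 2 * ‖y‖ := by
    simpa [hzero] using hΦ.hasFDerivAt.isLittleO.def (half_pos hε)
  obtain ⟨y, ⟨hy, hy'⟩, hne⟩ :=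
    (((hle.and hlittle).filter_mono nhdsWithin_le_nhds).and
      (self_mem_nhdsWithin (s := {(0 : E)}ᶜ))).exists
  nlinarith [(abs_le.1 hy').1, norm_pos_iff.2 hne]

variable [CompleteSpace E] {V : E → E}

theorem not_isLocalMax_of_inner_pos {e : E} (hΦ : ∀ᶠ y in 𝓝 x, HasGradientAt Φ (V y) y)
    (he : ∀ᶠ t in 𝓝[>] (0 : ℝ), 0 < ⟪V (x + t • e), e⟫) : ¬ IsLocalMax Φ x := by
  intro hmax
  refine not_isLocalMax_of_deriv_pos_right (g := fun t => Φ (x + t • e)) ?_ he ?_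
  · filter_upwards [(tendsto_add_smul_zero x e).eventually hΦ] with t ht
    have h := ht.hasFDerivAt.comp_hasDerivAt t (hasDerivAt_add_smul x e t)
    rwa [InnerProductSpace.toDual_apply_apply] at h
  · filter_upwards [(tendsto_add_smul_zero x e).eventually hmax] with t ht
    simpa using ht

theorem gradient_eq_zero_of_isLocalMax {v : E} (hΦ : HasGradientAt Φ v x)
    (hmax : IsLocalMax Φ x) : v = 0 :=
  (InnerProductSpace.toDual ℝ E).map_eq_zero_iff.1 (hmax.hasFDerivAt_eq_zero hΦ.hasFDerivAt)

theorem inner_hessian_nonpos_of_isLocalMax {H : E →L[ℝ] E}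
    (hΦ : ∀ᶠ y in 𝓝 x, HasGradientAt Φ (V y) y) (hV : HasFDerivAt V H x)
    (hmax : IsLocalMax Φ x) (h : E) : ⟪H h, h⟫ ≤ 0 := by
  by_contra! hpos
  exact not_isLocalMax_of_inner_pos hΦ (eventually_inner_pos hV
    (gradient_eq_zero_of_isLocalMax hΦ.self_of_nhds hmax) hpos) hmax

end LocalMax

theorem differentiableAt_fderiv {E F : Type*} [NormedAddCommGroup E] [NormedSpace ℝ E]
    [NormedAddCommGroup F] [NormedSpace ℝ F] {u : E → F} {x : E} (hu : ContDiffAt ℝ 2 u x) :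
    DifferentiableAt ℝ (fderiv ℝ u) x :=
  (hu.fderiv_right (m := 1) (by norm_num)).differentiableAt one_ne_zero

section Gradient

variable {E : Type*} [NormedAddCommGroup E] [InnerProductSpace ℝ E] [CompleteSpace E]
  {u : E → ℝ} {x : E}

theorem eventually_hasGradientAt (hu : ContDiffAt ℝ 2 u x) :
    ∀ᶠ y in 𝓝 x, HasGradientAt u (∇ u y) y := by
  filter_upwards [hu.eventually (by simp)] with y hy
  exact (hy.differentiableAt two_ne_zero).hasGradientAt

theorem hasFDerivAt_gradient (hu : ContDiffAt ℝ 2 u x) :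
    HasFDerivAt (∇ u) (fderiv ℝ (∇ u) x) x :=
  ((InnerProductSpace.toDual ℝ E).symm.differentiable.differentiableAt.comp x
    (differentiableAt_fderiv hu)).hasFDerivAt

theorem inner_fderiv_gradient (hu : ContDiffAt ℝ 2 u x) (v w : E) :
    ⟪fderiv ℝ (∇ u) x v, w⟫ = fderiv ℝ (fderiv ℝ u) x v w := by
  have hinner : HasFDerivAt (fun y => ⟪∇ u y, w⟫) (innerSL ℝ w ∘L fderiv ℝ (∇ u) x) x := by
    simpa [real_inner_comm, Function.comp_def] using
      (innerSL ℝ w).hasFDerivAt.comp x (hasFDerivAt_gradient hu)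
  have hflip : HasFDerivAt (fun y => fderiv ℝ u y w) ((fderiv ℝ (fderiv ℝ u) x).flip w) x := by
    simpa using (differentiableAt_fderiv hu).hasFDerivAt.clm_apply (hasFDerivAt_const w x)
  simp only [inner_gradient_left] at hinner
  simpa [real_inner_comm] using congrArg (fun L => L v) (hinner.unique hflip)

theorem isSymmetric_fderiv_gradient (hu : ContDiffAt ℝ 2 u x) :
    (fderiv ℝ (∇ u) x : E →ₗ[ℝ] E).IsSymmetric := fun v w => by
  rw [ContinuousLinearMap.coe_coe, inner_fderiv_gradient hu, real_inner_comm,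
    inner_fderiv_gradient hu]
  exact hu.isSymmSndFDerivAt (by simp) v w

theorem hasGradientAt_norm (hx : x ≠ 0) : HasGradientAt (‖·‖) (‖x‖ ^ ((1 : ℝ) - 2) • x) x := by
  have h := hasFDerivAt_norm_rpow_of_ne_zero 1 hx
  simp only [Real.rpow_one, one_mul] at h
  exact h.congr_fderiv (by ext; simp)

theorem hasGradientAt_comp_sub_norm {T : ℝ → ℝ} {τ : ℝ} {v : E} (hu : HasGradientAt u v x)
    (hT : HasDerivAt T τ (u x)) (hx : x ≠ 0) (c : ℝ) :
    HasGradientAt (fun y => T (u y) - c * ‖y‖) (τ • v - c • ‖x‖ ^ ((1 : ℝ) - 2) • x) x := by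
  refine ((hT.comp_hasFDerivAt x hu.hasFDerivAt).sub
    ((hasGradientAt_norm hx).hasFDerivAt.const_mul c)).congr_fderiv ?_
  ext
  simp

theorem hessian_le_of_isLocalMax (hx : x ≠ 0) (hu : ContDiffAt ℝ 2 u x) {T T₁ : ℝ → ℝ}
    {t₂ w : ℝ} (hT : ∀ᶠ s in 𝓝 (u x), HasDerivAt T (T₁ s) s) (hT₁ : HasDerivAt T₁ t₂ (u x))
    (hpos : 0 < T₁ (u x)) (hmax : IsLocalMax (fun y => T (u y) - T₁ (u x) * w * ‖y‖) x) :
    ∇ u x = w • ‖x‖⁻¹ • x ∧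
      ∀ h, ⟪fderiv ℝ (∇ u) x h, h⟫ ≤
        ⟪axial (‖x‖⁻¹ • x) (-t₂ * w ^ 2 / T₁ (u x)) (w / ‖x‖) h, h⟫ := by
  set τ := T₁ (u x)
  set H := fderiv ℝ (∇ u) x
  have hgrad : ∀ᶠ y in 𝓝 x, HasGradientAt (fun y => T (u y) - τ * w * ‖y‖)
      (T₁ (u y) • ∇ u y - (τ * w) • ‖y‖ ^ ((1 : ℝ) - 2) • y) y := by
    filter_upwards [eventually_hasGradientAt hu, hu.continuousAt.eventually hT,
      isOpen_ne.mem_nhds hx] with y hy hTy hy0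
    exact hasGradientAt_comp_sub_norm hy hTy hy0 _
  have hinv : ‖x‖ ^ ((1 : ℝ) - 2) = ‖x‖⁻¹ := by
    rw [← Real.rpow_neg_one]
    norm_num
  have hfirst : ∇ u x = w • ‖x‖⁻¹ • x := by
    have h := gradient_eq_zero_of_isLocalMax hgrad.self_of_nhds hmax
    rw [hinv, mul_smul, ← smul_sub, smul_eq_zero_iff_right hpos.ne'] at h
    exact sub_eq_zero.1 h
  refine ⟨hfirst, fun h => ?_⟩
  have hu' : HasFDerivAt u (InnerProductSpace.toDual ℝ E (∇ u x)) x :=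
    (eventually_hasGradientAt hu).self_of_nhds.hasFDerivAt
  have hsecond := inner_hessian_nonpos_of_isLocalMax hgrad
    (((hT₁.comp_hasFDerivAt x hu').smul (hasFDerivAt_gradient hu)).sub
      ((hasFDerivAt_norm_rpow_smul 1 hx).const_smul (τ * w))) hmax h
  simp only [Function.comp_apply, sub_apply, add_apply, smul_apply,
    ContinuousLinearMap.smulRight_apply, InnerProductSpace.toDual_apply_apply, hfirst, hinv,
    inner_sub_left, inner_add_left, real_inner_smul_left, inner_axial_self, smul_eq_mul,
    sub_self, zero_mul, zero_add] at hsecond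
  have hexpand : τ * ⟪axial (‖x‖⁻¹ • x) (-t₂ * w ^ 2 / τ) (w / ‖x‖) h, h⟫ =
      -(t₂ * w ^ 2 * ⟪‖x‖⁻¹ • x, h⟫ ^ 2) +
        τ * w * ‖x‖⁻¹ * (‖h‖ ^ 2 - ⟪‖x‖⁻¹ • x, h⟫ ^ 2) := by
    rw [inner_axial_self]
    field_simp
  refine le_of_mul_le_mul_left (hexpand.symm.le.trans' ?_) hpos
  rw [real_inner_smul_left]
  linarith

end Gradient

/-! ### Admissible subsolutions at interior maxima -/

section LocalMax

variable {n k : ℕ} {p : ℝ} {u : Rn n → ℝ} {x : Rn n} {lam : Fin n → ℝ}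

theorem not_isLocalMax_of_admissible (hkn : k ≤ n) (hu : ContDiff ℝ 1 u)
    (hd : DifferentiableAt ℝ (pGradField p u) x)
    (hlam : IsEigenvalueTuple (fderiv ℝ (pGradField p u) x) lam) (hcone : lam ∈ coneP n k) :
    ¬ IsLocalMax u x := by
  intro hmax
  have hgrad : ∀ y, HasGradientAt u (∇ u y) y := fun y =>
    (hu.differentiable one_ne_zero y).hasGradientAt
  obtain ⟨i, hi⟩ := exists_pos_of_mem_coneP hkn hcone
  have heig : Module.End.HasEigenvalue (fderiv ℝ (pGradField p u) x : Rn n →ₗ[ℝ] Rn n)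
      (lam i) := by
    rw [Module.End.hasEigenvalue_iff_isRoot_charpoly, hlam, Polynomial.IsRoot.def,
      Polynomial.eval_prod]
    exact Finset.prod_eq_zero (Finset.mem_univ i) (by simp)
  obtain ⟨e, he⟩ := heig.exists_hasEigenvector
  have hSe : fderiv ℝ (pGradField p u) x e = lam i • e := he.apply_eq_smul
  have hpos : 0 < ⟪fderiv ℝ (pGradField p u) x e, e⟫ := by
    rw [hSe, real_inner_smul_left]
    exact mul_pos hi (real_inner_self_pos.2 he.2)
  have hzero : pGradField p u x = 0 := by
    rw [pGradField, gradient_eq_zero_of_isLocalMax (hgrad x) hmax, smul_zero]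
  refine not_isLocalMax_of_inner_pos (e := e) (Eventually.of_forall hgrad) ?_ hmax
  filter_upwards [eventually_inner_pos hd.hasFDerivAt hzero hpos] with t ht
  rw [pGradField, real_inner_smul_left] at ht
  exact pos_of_mul_pos_right ht (by positivity)

theorem exists_le_spike_of_isLocalMax (hp : 1 < p) (hx : x ≠ 0) (hu : ContDiffAt ℝ 2 u x)
    {T T₁ : ℝ → ℝ} {t₂ w : ℝ} (hT : ∀ᶠ s in 𝓝 (u x), HasDerivAt T (T₁ s) s)
    (hT₁ : HasDerivAt T₁ t₂ (u x)) (hpos : 0 < T₁ (u x)) (hw : w ≠ 0)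
    (hmax : IsLocalMax (fun y => T (u y) - T₁ (u x) * w * ‖y‖) x)
    (hlam : IsEigenvalueTuple (fderiv ℝ (pGradField p u) x) lam) :
    ‖∇ u x‖ = |w| ∧ ∃ j, lam ≤ spike j ((p - 1) * |w| ^ (p - 2) * (-t₂ * w ^ 2 / T₁ (u x)))
      (|w| ^ (p - 2) * (w / ‖x‖)) := by
  have hν : ‖‖x‖⁻¹ • x‖ = 1 := norm_smul_inv_norm (𝕜 := ℝ) hx
  obtain ⟨hgrad, hle⟩ := hessian_le_of_isLocalMax hx hu hT hT₁ hpos hmax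
  refine ⟨by rw [hgrad, norm_smul, hν, mul_one, Real.norm_eq_abs], ?_⟩
  exact exists_le_spike_of_hessian_le hp (hasFDerivAt_gradient hu)
    (isSymmetric_fderiv_gradient hu) hν hw hgrad hle hlam

end LocalMax

/-- The maximum of `u` over the sphere of radius `|r|` about the origin. -/
noncomputable def sphereMax {n : ℕ} (u : Rn n → ℝ) (r : ℝ) : ℝ :=
  sSup ((fun z => u (r • z)) '' Metric.sphere (0 : Rn n) 1)

section SphereMax

variable {n : ℕ} {u : Rn n → ℝ}

theorem continuous_sphereMax (hu : Continuous u) : Continuous (sphereMax u) :=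
  IsCompact.continuous_sSup (f := fun r z => u (r • z)) (isCompact_sphere 0 1)
    (by simp only [Function.HasUncurry.uncurry]; fun_prop)

theorem le_sphereMax (hu : Continuous u) {x : Rn n} (hx : x ≠ 0) : u x ≤ sphereMax u ‖x‖ := by
  have hx' : ‖x‖ ≠ 0 := norm_ne_zero_iff.2 hx
  refine le_csSup ((isCompact_sphere 0 1).image (by fun_prop)).bddAbove ⟨‖x‖⁻¹ • x, ?_, ?_⟩
  · simp [norm_smul, hx']
  · simp [smul_smul, hx']

theorem exists_eq_sphereMax [Nontrivial (Rn n)] (hu : Continuous u) {r : ℝ} (hr : 0 < r) :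
    ∃ x, ‖x‖ = r ∧ u x = sphereMax u r := by
  have hne : (Metric.sphere (0 : Rn n) 1).Nonempty := NormedSpace.sphere_nonempty.2 zero_le_one
  obtain ⟨z, hz, h⟩ := ((isCompact_sphere (0 : Rn n) 1).image
    (f := fun z => u (r • z)) (by fun_prop)).sSup_mem (hne.image _)
  refine ⟨r • z, ?_, h⟩
  rw [norm_smul, Real.norm_of_nonneg hr.le, mem_sphere_zero_iff_norm.1 hz, mul_one]

end SphereMax

namespace IsEntireSubsolution

variable {n k : ℕ} {p α β : ℝ} {f : ℝ → ℝ} {u : Rn n → ℝ} {r₁ r₂ : ℝ}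

theorem contDiffAt (hu : IsEntireSubsolution n k p α β f u) {x : Rn n} (hx : x ≠ 0) :
    ContDiffAt ℝ 2 u x :=
  hu.contDiffOn_two.contDiffAt (isOpen_compl_singleton.mem_nhds hx)

theorem not_isLocalMax_add_norm [Nontrivial (Rn n)] (hk : 1 ≤ k) (hkn : k ≤ n) (hp : 1 < p)
    (hu : IsEntireSubsolution n k p α β f u) {ε : ℝ} (hε : 0 < ε) (x : Rn n) :
    ¬ IsLocalMax (fun y => u y + ε * ‖y‖) x := by
  intro hmax
  obtain rfl | hx := eq_or_ne x 0
  · exact not_isLocalMax_add_norm_zero (hu.contDiff_one.differentiable one_ne_zero 0) hε hmax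
  obtain ⟨-, -, lam, hlam, hcone, -⟩ := hu.subsolution x hx
  obtain ⟨-, j, hj⟩ := exists_le_spike_of_isLocalMax (T := id) (T₁ := fun _ => 1) (t₂ := 0)
    (w := -ε) hp hx (hu.contDiffAt hx) (Eventually.of_forall hasDerivAt_id)
    (hasDerivAt_const _ _) one_pos (neg_ne_zero.2 hε.ne') (by simpa using hmax) hlam
  refine spike_notMem_coneP hk hkn (by simp) ?_ (isUpperSet_coneP hj hcone)
  exact mul_nonpos_of_nonneg_of_nonpos (by positivity)
    (div_nonpos_of_nonpos_of_nonneg (by linarith) (norm_nonneg x))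

theorem sphereMax_le [Nontrivial (Rn n)] (hk : 1 ≤ k) (hkn : k ≤ n) (hp : 1 < p)
    (hu : IsEntireSubsolution n k p α β f u) (hr₁ : 0 < r₁) (hr : r₁ < r₂) :
    sphereMax u r₁ ≤ sphereMax u r₂ := by
  have huc := hu.contDiff_one.continuous
  have hr₂ : 0 < r₂ := hr₁.trans hr
  by_contra! hlt
  obtain ⟨y, hy, hyM⟩ := exists_eq_sphereMax huc hr₁
  set ε := (sphereMax u r₁ - sphereMax u r₂) / r₂ with hε
  have hεr : ε * r₂ = sphereMax u r₁ - sphereMax u r₂ := by rw [hε]; field_simp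
  have hε0 : 0 < ε := div_pos (sub_pos.2 hlt) hr₂
  obtain ⟨x, hx, hxmax⟩ := (isCompact_closedBall (0 : Rn n) r₂).exists_isMaxOn
    ⟨0, by simp [hr₂.le]⟩ (f := fun y => u y + ε * ‖y‖) (by fun_prop)
  have hyx : u y + ε * ‖y‖ ≤ u x + ε * ‖x‖ := hxmax (by simp [hy, hr.le])
  have hxr : ‖x‖ < r₂ := by
    refine lt_of_le_of_ne (by simpa using hx) fun h => ?_
    have hle := le_sphereMax huc (x := x) (norm_ne_zero_iff.1 (by rw [h]; exact hr₂.ne'))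
    rw [hyM, hy, h] at hyx
    rw [h] at hle
    nlinarith
  exact hu.not_isLocalMax_add_norm hk hkn hp hε0 x
    (hxmax.isLocalMax (Metric.closedBall_mem_nhds_of_mem (by simpa using hxr)))

theorem sphereMax_lt [Nontrivial (Rn n)] (hk : 1 ≤ k) (hkn : k ≤ n) (hp : 1 < p)
    (hu : IsEntireSubsolution n k p α β f u) (hr₁ : 0 < r₁) (hr : r₁ < r₂) :
    sphereMax u r₁ < sphereMax u r₂ := by
  have huc := hu.contDiff_one.continuous
  refine lt_of_le_of_ne (hu.sphereMax_le hk hkn hp hr₁ hr) fun heq => ?_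
  obtain ⟨y, hy, hyM⟩ := exists_eq_sphereMax huc (r := (r₁ + r₂) / 2) (by linarith)
  have hy0 : y ≠ 0 := norm_ne_zero_iff.1 (by rw [hy]; linarith)
  obtain ⟨hd, -, lam, hlam, hcone, -⟩ := hu.subsolution y hy0
  refine not_isLocalMax_of_admissible hkn hu.contDiff_one hd hlam hcone ?_
  have hnhds : ∀ᶠ z in 𝓝 y, ‖z‖ ∈ Ioo r₁ r₂ :=
    continuous_norm.continuousAt.eventually
      (Ioo_mem_nhds (by simp only [hy]; linarith) (by simp only [hy]; linarith))
  filter_upwards [hnhds] with z hz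
  calc u z ≤ sphereMax u ‖z‖ :=
        le_sphereMax huc (norm_pos_iff.1 (hr₁.trans hz.1))
    _ ≤ sphereMax u r₂ := hu.sphereMax_le hk hkn hp (hr₁.trans hz.1) hz.2
    _ = sphereMax u r₁ := heq.symm
    _ ≤ sphereMax u ((r₁ + r₂) / 2) := hu.sphereMax_le hk hkn hp hr₁ (by linarith)
    _ = u y := hyM.symm

end IsEntireSubsolution

/-! ### The Keller–Osserman condition -/

theorem half_mul_le_setIntegral_of_antitoneOn {g : ℝ → ℝ} {t₀ t : ℝ}
    (hg : AntitoneOn g (Ioi t₀)) (hg0 : ∀ s ∈ Ioi t₀, 0 ≤ g s) (hint : IntegrableOn g (Ioi t₀))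
    (ht₀ : 0 < t₀) (ht : 2 * t₀ < t) : t / 2 * g t ≤ ∫ s in Ioi t₀, g s := by
  have hsub : Ioc (t / 2) t ⊆ Ioi t₀ := fun s hs => mem_Ioi.2 (by linarith [hs.1])
  calc t / 2 * g t = ∫ _ in Ioc (t / 2) t, g t := by
        rw [setIntegral_const, Real.volume_real_Ioc_of_le (by linarith), smul_eq_mul]
        ring
    _ ≤ ∫ s in Ioc (t / 2) t, g s :=
        setIntegral_mono_on (by simp) (hint.mono_set hsub) measurableSet_Ioc fun s hs =>
          hg (hsub hs) (mem_Ioi.2 (by linarith)) hs.2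
    _ ≤ ∫ s in Ioi t₀, g s :=
        setIntegral_mono_set hint (ae_restrict_of_forall_mem measurableSet_Ioi hg0)
          hsub.eventuallyLE

theorem mul_rpow_le_of_rpow_le {c t x κ q : ℝ} (hc : 0 < c) (ht : 0 < t) (hx : 0 < x)
    (hκ : 1 ≤ κ) (hq : 0 < q) (h : (c * t) ^ (q + 1) ≤ x) :
    c ^ (κ - 1) * x ^ ((κ * q + 1) / (q + 1)) ≤ t ^ (1 - κ) * x ^ κ := by
  have hpow : (c * t) ^ (κ - 1) ≤ x ^ ((κ - 1) / (q + 1)) := by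
    have h' := Real.rpow_le_rpow (by positivity) h
      (div_nonneg (sub_nonneg.2 hκ) (by linarith : (0 : ℝ) ≤ q + 1))
    rwa [← Real.rpow_mul (by positivity), mul_div_cancel₀ _ (by positivity)] at h'
  have hsplit : x ^ κ = x ^ ((κ - 1) / (q + 1)) * x ^ ((κ * q + 1) / (q + 1)) := by
    rw [← Real.rpow_add hx]
    congr 1
    field_simp
    ring
  have hcancel : t ^ (1 - κ) * t ^ (κ - 1) = 1 := by
    rw [← Real.rpow_add ht]
    simp
  calc c ^ (κ - 1) * x ^ ((κ * q + 1) / (q + 1))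
      = t ^ (1 - κ) * ((c * t) ^ (κ - 1) * x ^ ((κ * q + 1) / (q + 1))) := by
        rw [Real.mul_rpow hc.le ht.le]
        linear_combination (-(c ^ (κ - 1) * x ^ ((κ * q + 1) / (q + 1)))) * hcancel
    _ ≤ t ^ (1 - κ) * x ^ κ := by
        rw [hsplit]
        gcongr

section Integral

variable {F : ℝ → ℝ} {q κ t t₀ : ℝ}

theorem continuous_integral_of_continuous (hF : Continuous F) (a : ℝ) :
    Continuous fun t => ∫ s in a..t, F s :=
  continuous_iff_continuousAt.2 fun t => (hF.integral_hasStrictDerivAt a t).hasDerivAt.continuousAt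

theorem integral_pos_of_continuous (hF : Continuous F) (hpos : ∀ s, 0 < F s) {a b : ℝ}
    (hab : a < b) : 0 < ∫ s in a..b, F s :=
  intervalIntegral.intervalIntegral_pos_of_pos_on (hF.intervalIntegrable a b) (fun s _ => hpos s)
    hab

theorem continuousOn_integral_rpow (hF : Continuous F) (hpos : ∀ s, 0 < F s) (e : ℝ) :
    ContinuousOn (fun t => (∫ s in (0 : ℝ)..t, F s) ^ e) (Ioi 0) :=
  (continuous_integral_of_continuous hF 0).continuousOn.rpow_const fun _ ht =>
    Or.inl (integral_pos_of_continuous hF hpos ht).ne'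

theorem integral_rpow_nonneg (hF : Continuous F) (hpos : ∀ s, 0 < F s) (e : ℝ) (ht : 0 < t) :
    0 ≤ (∫ s in (0 : ℝ)..t, F s) ^ e :=
  Real.rpow_nonneg (integral_pos_of_continuous hF hpos ht).le e

theorem monotone_integral_of_nonneg (hF : Continuous F) (hF0 : ∀ s, 0 ≤ F s) (a : ℝ) :
    Monotone fun t => ∫ s in a..t, F s :=
  monotone_of_hasDerivAt_nonneg (fun t => (hF.integral_hasStrictDerivAt a t).hasDerivAt) hF0

theorem antitoneOn_integral_rpow (hF : Continuous F) (hpos : ∀ s, 0 < F s) {e : ℝ} (he : e ≤ 0) :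
    AntitoneOn (fun t => (∫ s in (0 : ℝ)..t, F s) ^ e) (Ioi 0) := fun _ hs _ _ hst =>
  Real.rpow_le_rpow_of_nonpos (integral_pos_of_continuous hF hpos hs)
    (monotone_integral_of_nonneg hF (fun s => (hpos s).le) 0 hst) he

theorem integrableOn_integral_rpow_iff (hF : Continuous F) (hpos : ∀ s, 0 < F s) (e : ℝ)
    (ht₀ : 0 < t₀) :
    IntegrableOn (fun t => (∫ s in (0 : ℝ)..t, F s) ^ e) (Ioi t₀) ↔
      ∫⁻ t in Ioi t₀, ENNReal.ofReal ((∫ s in (0 : ℝ)..t, F s) ^ e) ≠ ⊤ := by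
  have hmeas : AEStronglyMeasurable (fun t => (∫ s in (0 : ℝ)..t, F s) ^ e)
      (volume.restrict (Ioi t₀)) :=
    ((continuousOn_integral_rpow hF hpos e).mono (Ioi_subset_Ioi ht₀.le)).aestronglyMeasurable
      measurableSet_Ioi
  have hnn : 0 ≤ᵐ[volume.restrict (Ioi t₀)] fun t => (∫ s in (0 : ℝ)..t, F s) ^ e :=
    ae_restrict_of_forall_mem measurableSet_Ioi fun t ht =>
      integral_rpow_nonneg hF hpos e (ht₀.trans ht)
  rw [IntegrableOn, ← lintegral_ofReal_ne_top_iff_integrable hmeas hnn]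

theorem not_kellerOsserman_iff (hF : Continuous F) (hpos : ∀ s, 0 < F s) :
    ¬ KellerOsserman F q ↔
      ∃ t₀ > 0, IntegrableOn (fun t => (∫ s in (0 : ℝ)..t, F s) ^ (-(1 / (q + 1)))) (Ioi t₀) := by
  unfold KellerOsserman
  push Not
  exact exists_congr fun t₀ => and_congr_right fun ht₀ =>
    (integrableOn_integral_rpow_iff hF hpos _ ht₀).symm

theorem rpow_mul_integral_rpow_le (hF : Continuous F) (hpos : ∀ s, 0 < F s) (hκ : 1 ≤ κ)
    (ht : 0 < t) :
    t ^ (1 - κ) * (∫ s in (0 : ℝ)..t, F s) ^ κ ≤ ∫ s in (0 : ℝ)..t, F s ^ κ := by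
  have hFκ : Continuous fun s => F s ^ κ := hF.rpow_const fun s => Or.inl (hpos s).ne'
  have hjensen : (⨍ s in (0 : ℝ)..t, F s) ^ κ ≤ ⨍ s in (0 : ℝ)..t, F s ^ κ := by
    rw [uIoc_of_le ht.le]
    exact (convexOn_rpow hκ).map_set_average_le
      (continuousOn_id.rpow_const fun _ _ => Or.inr (by linarith)) isClosed_Ici
      (by simp [ht]) (by simp) (ae_of_all _ fun s => (hpos s).le)
      (hF.integrableOn_Ioc) (hFκ.integrableOn_Ioc)
  rw [interval_average_eq_div, interval_average_eq_div, sub_zero, le_div_iff₀ ht,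
    Real.div_rpow (integral_pos_of_continuous hF hpos ht).le ht.le] at hjensen
  rw [Real.rpow_sub ht, Real.rpow_one]
  exact hjensen.trans_eq' (by ring)

theorem exists_mul_rpow_le_integral (hF : Continuous F) (hpos : ∀ s, 0 < F s) (hq : 0 < q)
    (ht₀ : 0 < t₀)
    (hint : IntegrableOn (fun t => (∫ s in (0 : ℝ)..t, F s) ^ (-(1 / (q + 1)))) (Ioi t₀)) :
    ∃ c > 0, ∀ t, 2 * t₀ < t → (c * t) ^ (q + 1) ≤ ∫ s in (0 : ℝ)..t, F s := by
  have hnn : ∀ s ∈ Ioi t₀, 0 ≤ (∫ s in (0 : ℝ)..s, F s) ^ (-(1 / (q + 1))) := fun s hs =>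
    integral_rpow_nonneg hF hpos _ (ht₀.trans hs)
  set C := ∫ t in Ioi t₀, (∫ s in (0 : ℝ)..t, F s) ^ (-(1 / (q + 1)))
  have hC : 0 ≤ C := setIntegral_nonneg measurableSet_Ioi hnn
  have hq1 : 0 < 1 / (q + 1) := by positivity
  refine ⟨(2 * (C + 1))⁻¹, by positivity, fun t ht => ?_⟩
  have ht0 : 0 < t := by linarith
  have hI := integral_pos_of_continuous hF hpos ht0
  have hbound := half_mul_le_setIntegral_of_antitoneOn ((antitoneOn_integral_rpow hF hpos
    (neg_nonpos.2 hq1.le)).mono (Ioi_subset_Ioi ht₀.le)) hnn hint ht₀ ht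
  rw [Real.rpow_neg hI.le, ← div_eq_mul_inv, div_le_iff₀ (by positivity)] at hbound
  rw [← Real.le_rpow_inv_iff_of_pos (by positivity) hI.le (by linarith), ← one_div (q + 1),
    inv_mul_le_iff₀ (by positivity)]
  nlinarith [Real.rpow_pos_of_pos hI (1 / (q + 1))]

theorem KellerOsserman.of_rpow (hF : Continuous F) (hpos : ∀ s, 0 < F s) (hκ : 1 ≤ κ)
    (hq : 0 < q) (h : KellerOsserman (fun s => F s ^ κ) (κ * q)) : KellerOsserman F q := by
  have hFκ : Continuous fun s => F s ^ κ := hF.rpow_const fun s => Or.inl (hpos s).ne'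
  have hposκ : ∀ s, 0 < F s ^ κ := fun s => Real.rpow_pos_of_pos (hpos s) κ
  contrapose h
  obtain ⟨t₀, ht₀, hint⟩ := (not_kellerOsserman_iff hF hpos).1 h
  obtain ⟨c, hc, hgrowth⟩ := exists_mul_rpow_le_integral hF hpos hq ht₀ hint
  refine (not_kellerOsserman_iff hFκ hposκ).2 ⟨2 * t₀, by linarith, ?_⟩
  have hdom : IntegrableOn (fun t => (c ^ (κ - 1)) ^ (-(1 / (κ * q + 1))) *
      (∫ s in (0 : ℝ)..t, F s) ^ (-(1 / (q + 1)))) (Ioi (2 * t₀)) :=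
    (hint.mono_set (Ioi_subset_Ioi (by linarith))).const_mul _
  refine hdom.mono' (((continuousOn_integral_rpow hFκ hposκ _).mono
    (Ioi_subset_Ioi (by linarith))).aestronglyMeasurable measurableSet_Ioi)
    (ae_restrict_of_forall_mem measurableSet_Ioi fun t (ht : 2 * t₀ < t) => ?_)
  have ht0 : 0 < t := by linarith
  have hI := integral_pos_of_continuous hF hpos ht0
  rw [Real.norm_of_nonneg (integral_rpow_nonneg hFκ hposκ _ ht0)]
  calc (∫ s in (0 : ℝ)..t, F s ^ κ) ^ (-(1 / (κ * q + 1)))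
      ≤ (c ^ (κ - 1) * (∫ s in (0 : ℝ)..t, F s) ^ ((κ * q + 1) / (q + 1))) ^
          (-(1 / (κ * q + 1))) :=
        Real.rpow_le_rpow_of_nonpos (by positivity)
          ((mul_rpow_le_of_rpow_le hc ht0 hI hκ hq (hgrowth t ht)).trans
            (rpow_mul_integral_rpow_le hF hpos hκ ht0)) (by rw [neg_nonpos]; positivity)
    _ = (c ^ (κ - 1)) ^ (-(1 / (κ * q + 1))) * (∫ s in (0 : ℝ)..t, F s) ^ (-(1 / (q + 1))) := by
        rw [Real.mul_rpow (by positivity) (by positivity), ← Real.rpow_mul hI.le]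
        congr 2
        field_simp

theorem KellerOsserman.exists_integral_gt (hF : Continuous F) (hpos : ∀ s, 0 < F s)
    (h : KellerOsserman F q) (M : ℝ) :
    ∃ s > 1, M < ∫ t in (1 : ℝ)..s, (∫ τ in (0 : ℝ)..t, F τ) ^ (-(1 / (q + 1))) := by
  by_contra! hbound
  refine (integrableOn_integral_rpow_iff hF hpos (-(1 / (q + 1))) one_pos).1 ?_ (h 1 one_pos)
  refine integrableOn_Ioi_of_intervalIntegral_norm_bounded M 1 (l := atTop) (b := id)
    (fun s => ?_) tendsto_id ?_
  · refine (((continuousOn_integral_rpow hF hpos _).mono fun t ht =>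
      ?_).integrableOn_Icc (a := 1) (b := s)).mono_set Ioc_subset_Icc_self
    exact one_pos.trans_le ht.1
  · filter_upwards [eventually_gt_atTop 1] with s hs
    refine (intervalIntegral.integral_congr fun t ht => ?_).trans_le (hbound s hs)
    rw [id, uIcc_of_le hs.le] at ht
    exact Real.norm_of_nonneg (integral_rpow_nonneg hF hpos _ (one_pos.trans_le ht.1))

end Integral

/-! ### Barrier profiles -/

/-- Slope, as a function of the value, of the increasing solutions of `(φ' ^ q)' = lam * G'(φ)`;
the energy identity `φ' ^ (q + 1) = B ^ (q + 1) + lam * (1 + 1 / q) * G(φ)` determines it from the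
slope `B` at the zeros of `G`. -/
noncomputable def profile (q B lam : ℝ) (G : ℝ → ℝ) (s : ℝ) : ℝ :=
  (B ^ (q + 1) + lam * (1 + 1 / q) * G s) ^ (1 / (q + 1))

/-- Time in which a solution of `φ' = profile q B lam G φ` climbs from the value `A` to the value
`s`, in other words the inverse function of the solution starting at `A`. -/
noncomputable def climbTime (q B lam : ℝ) (G : ℝ → ℝ) (A s : ℝ) : ℝ :=
  ∫ x in A..s, (profile q B lam G x)⁻¹

section Profile

variable {q B lam : ℝ} {G : ℝ → ℝ}

theorem profile_base_pos (hq : 0 < q) (hB : 0 < B) (hlam : 0 ≤ lam) (hG : ∀ s, 0 ≤ G s) (s : ℝ) :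
    0 < B ^ (q + 1) + lam * (1 + 1 / q) * G s := by
  have := hG s
  positivity

theorem profile_pos (hq : 0 < q) (hB : 0 < B) (hlam : 0 ≤ lam) (hG : ∀ s, 0 ≤ G s) (s : ℝ) :
    0 < profile q B lam G s :=
  Real.rpow_pos_of_pos (profile_base_pos hq hB hlam hG s) _

theorem inv_profile_eq (hq : 0 < q) (hB : 0 < B) (hlam : 0 ≤ lam) (hG : ∀ s, 0 ≤ G s) (s : ℝ) :
    (profile q B lam G s)⁻¹ =
      (B ^ (q + 1) + lam * (1 + 1 / q) * G s) ^ (-(1 / (q + 1))) :=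
  (Real.rpow_neg (profile_base_pos hq hB hlam hG s).le _).symm

theorem rpow_succ_rpow_one_div (hq : 0 < q) (hB : 0 ≤ B) : (B ^ (q + 1)) ^ (1 / (q + 1)) = B := by
  rw [one_div, Real.rpow_rpow_inv hB (by linarith)]

theorem profile_eq_of_eq_zero (hq : 0 < q) (hB : 0 ≤ B) {s : ℝ} (hs : G s = 0) :
    profile q B lam G s = B := by
  rw [profile, hs, mul_zero, add_zero, rpow_succ_rpow_one_div hq hB]

theorem le_profile (hq : 0 < q) (hB : 0 ≤ B) (hlam : 0 ≤ lam) {s : ℝ} (hs : 0 ≤ G s) :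
    B ≤ profile q B lam G s := by
  calc B = (B ^ (q + 1)) ^ (1 / (q + 1)) := (rpow_succ_rpow_one_div hq hB).symm
    _ ≤ profile q B lam G s := by
      refine Real.rpow_le_rpow (by positivity) (le_add_of_nonneg_right ?_) (by positivity)
      positivity

theorem continuous_profile (hq : 0 < q) (hB : 0 < B) (hlam : 0 ≤ lam) (hG : ∀ s, 0 ≤ G s)
    (hGc : Continuous G) : Continuous (profile q B lam G) :=
  Continuous.rpow_const (by fun_prop) fun s => Or.inl (profile_base_pos hq hB hlam hG s).ne'

theorem continuous_inv_profile (hq : 0 < q) (hB : 0 < B) (hlam : 0 ≤ lam) (hG : ∀ s, 0 ≤ G s)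
    (hGc : Continuous G) : Continuous fun s => (profile q B lam G s)⁻¹ :=
  (continuous_profile hq hB hlam hG hGc).inv₀ fun s => (profile_pos hq hB hlam hG s).ne'

theorem hasDerivAt_profile (hq : 0 < q) (hB : 0 < B) (hlam : 0 ≤ lam) (hG : ∀ s, 0 ≤ G s)
    {s g : ℝ} (hg : HasDerivAt G g s) :
    HasDerivAt (profile q B lam G) (lam * g / (q * profile q B lam G s ^ q)) s := by
  have hbase := profile_base_pos hq hB hlam hG s
  have hpow : profile q B lam G s ^ q =
      ((B ^ (q + 1) + lam * (1 + 1 / q) * G s) ^ (1 / (q + 1) - 1))⁻¹ := by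
    rw [profile, ← Real.rpow_mul hbase.le, ← Real.rpow_neg hbase.le]
    congr 1
    field_simp
    ring
  refine (((hg.const_mul (lam * (1 + 1 / q))).const_add (B ^ (q + 1))).rpow_const
    (p := 1 / (q + 1)) (Or.inl hbase.ne')).congr_deriv ?_
  rw [hpow]
  field_simp

theorem hasDerivAt_climbTime (hq : 0 < q) (hB : 0 < B) (hlam : 0 ≤ lam) (hG : ∀ s, 0 ≤ G s)
    (hGc : Continuous G) (A s : ℝ) :
    HasDerivAt (climbTime q B lam G A) (profile q B lam G s)⁻¹ s :=
  ((continuous_inv_profile hq hB hlam hG hGc).integral_hasStrictDerivAt A s).hasDerivAt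

theorem continuous_climbTime (hq : 0 < q) (hB : 0 < B) (hlam : 0 ≤ lam) (hG : ∀ s, 0 ≤ G s)
    (hGc : Continuous G) (A : ℝ) : Continuous (climbTime q B lam G A) :=
  continuous_integral_of_continuous (continuous_inv_profile hq hB hlam hG hGc) A

theorem strictMono_climbTime (hq : 0 < q) (hB : 0 < B) (hlam : 0 ≤ lam) (hG : ∀ s, 0 ≤ G s)
    (hGc : Continuous G) (A : ℝ) : StrictMono (climbTime q B lam G A) :=
  strictMono_of_hasDerivAt_pos (fun s => hasDerivAt_climbTime hq hB hlam hG hGc A s)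
    fun s => inv_pos.2 (profile_pos hq hB hlam hG s)

@[simp]
theorem climbTime_self (A : ℝ) : climbTime q B lam G A A = 0 :=
  intervalIntegral.integral_same

theorem profile_rpow_le (hq : 0 < q) (hB : 0 < B) (hlam : 0 ≤ lam) (hG : ∀ s, 0 ≤ G s)
    (hGc : Continuous G) {F : ℝ → ℝ} (hF : Monotone F) {A : ℝ}
    (hGd : ∀ s, A < s → HasDerivAt G (F s) s) (hGA : G A = 0) {s : ℝ} (hs : A ≤ s) :
    profile q B lam G s ^ q ≤ B ^ q + lam * F s * climbTime q B lam G A s := by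
  have hΦ := profile_pos hq hB hlam hG
  have hderiv : ∀ τ ∈ interior (Icc A s), HasDerivAt
      (fun τ => lam * F s * climbTime q B lam G A τ - profile q B lam G τ ^ q)
      (lam * (F s - F τ) * (profile q B lam G τ)⁻¹) τ := by
    intro τ hτ
    rw [interior_Icc] at hτ
    refine (((hasDerivAt_climbTime hq hB hlam hG hGc A τ).const_mul (lam * F s)).sub
      ((hasDerivAt_profile hq hB hlam hG (hGd τ hτ.1)).rpow_const (p := q)
        (Or.inl (hΦ τ).ne'))).congr_deriv ?_
    have := hΦ τ
    rw [Real.rpow_sub_one this.ne']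
    field_simp
  have hmono : MonotoneOn
      (fun τ => lam * F s * climbTime q B lam G A τ - profile q B lam G τ ^ q) (Icc A s) := by
    refine monotoneOn_of_deriv_nonneg (convex_Icc A s) ?_
      (fun τ hτ => (hderiv τ hτ).differentiableAt.differentiableWithinAt) fun τ hτ => ?_
    · exact (((continuous_climbTime hq hB hlam hG hGc A).const_mul _).sub
        ((continuous_profile hq hB hlam hG hGc).rpow_const
          fun x => Or.inl (hΦ x).ne')).continuousOn
    · rw [(hderiv τ hτ).deriv]
      rw [interior_Icc] at hτ
      exact mul_nonneg (mul_nonneg hlam (sub_nonneg.2 (hF hτ.2.le))) (inv_nonneg.2 (hΦ τ).le)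
  have hle := hmono ⟨le_rfl, hs⟩ ⟨hs, le_rfl⟩ hs
  simp only [climbTime_self, profile_eq_of_eq_zero hq hB.le hGA] at hle
  linarith

end Profile

/-! ### The radial form of the subsolution inequality -/

section Radial

variable {n k : ℕ} {p α β r w y X : ℝ}

theorem weight_rpow_eq (hk : 1 ≤ k) (hkn : k ≤ n) (hr : 0 < r) (hw : 0 < w) (hy : 0 < y) :
    (r ^ α * w ^ β * y) ^ ((n : ℝ) / k) =
      r ^ (n * (α + 1) / k - 1) * y ^ ((n : ℝ) / k) *
        (w ^ (β * n / k) * r ^ (-(((n : ℝ) - k) / k))) := by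
  have : (0 : ℝ) < k := by exact_mod_cast hk
  have : (0 : ℝ) < n := by exact_mod_cast hk.trans hkn
  rw [Real.mul_rpow (by positivity) hy.le, Real.mul_rpow (by positivity) (by positivity),
    ← Real.rpow_mul hr.le, ← Real.rpow_mul hw.le,
    show α * ((n : ℝ) / k) = (n * (α + 1) / k - 1) + -(((n : ℝ) - k) / k) by field_simp; ring,
    Real.rpow_add hr, ← mul_div_assoc β]
  ring

theorem radial_operator_rpow_eq (hk : 1 ≤ k) (hkn : k ≤ n) (hr : 0 < r) (hw : 0 < w)
    (hX : 0 < X) :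
    ((w ^ (p - 1) * X) ^ ((k : ℝ) / n) *
        (k * (w ^ (p - 1) / r)) ^ (((n : ℝ) - k) / n)) ^ ((n : ℝ) / k) =
      (k : ℝ) ^ (((n : ℝ) - k) / k) * (w ^ (n * (p - β - 1) / k) * X) *
        (w ^ (β * n / k) * r ^ (-(((n : ℝ) - k) / k))) := by
  have hk' : (0 : ℝ) < k := by exact_mod_cast hk
  have hn' : (0 : ℝ) < n := by exact_mod_cast hk.trans hkn
  set s : ℝ := ((n : ℝ) - k) / k with hs
  have hw_exp : w ^ (p - 1) * w ^ ((p - 1) * s) =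
      w ^ (n * (p - β - 1) / k) * w ^ (β * n / k) := by
    rw [← Real.rpow_add hw, ← Real.rpow_add hw]
    congr 1
    rw [hs]
    field_simp
    ring
  rw [Real.mul_rpow (by positivity) (by positivity), ← Real.rpow_mul (by positivity),
    ← Real.rpow_mul (by positivity), show (k : ℝ) / n * (n / k) = 1 by field_simp,
    show ((n : ℝ) - k) / n * (n / k) = s by rw [hs]; field_simp, Real.rpow_one,
    Real.mul_rpow hk'.le (by positivity), Real.div_rpow (by positivity) hr.le,
    ← Real.rpow_mul hw.le, Real.rpow_neg hr.le]
  linear_combination ((k : ℝ) ^ s * X / r ^ s) * hw_exp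

theorem weight_le_PiK_spike_iff (hk : 1 ≤ k) (hkn : k ≤ n) (j : Fin n) {κ : ℝ} (hr : 0 < r)
    (hw : 0 < w) (hy : 0 < y) (hκ : 0 < κ + ((k : ℝ) - 1) / r) :
    r ^ α * w ^ β * y ≤
        PiK n k (spike j (w ^ (p - 1) * κ) (w ^ (p - 1) / r)) ^ (1 / (n.choose k : ℝ)) ↔
      r ^ (n * (α + 1) / k - 1) * y ^ ((n : ℝ) / k) ≤
        (k : ℝ) ^ (((n : ℝ) - k) / k) *
          (w ^ (n * (p - β - 1) / k) * (κ + ((k : ℝ) - 1) / r)) := by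
  have : (0 : ℝ) < k := by exact_mod_cast hk
  have : (0 : ℝ) < n := by exact_mod_cast hk.trans hkn
  have hsum : w ^ (p - 1) * κ + ((k : ℝ) - 1) * (w ^ (p - 1) / r) =
      w ^ (p - 1) * (κ + ((k : ℝ) - 1) / r) := by ring
  rw [PiK_spike_rpow hk hkn (by rw [hsum]; positivity) (by positivity), hsum,
    ← Real.rpow_le_rpow_iff (z := (n : ℝ) / k) (by positivity) (by positivity) (by positivity),
    weight_rpow_eq hk hkn hr hw hy, radial_operator_rpow_eq (β := β) hk hkn hr hw hκ]
  exact mul_le_mul_iff_of_pos_right (by positivity)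

end Radial

section Shift

variable {F : ℝ → ℝ} {q e A t t₀ : ℝ}

theorem integrableOn_Ioc_integral_rpow (hF : Continuous F) (hpos : ∀ s, 0 < F s)
    (hmono : Monotone F) (he₀ : 0 ≤ e) (he₁ : e < 1) (ht : 0 ≤ t) :
    IntegrableOn (fun t => (∫ s in (0 : ℝ)..t, F s) ^ (-e)) (Ioc 0 t) := by
  have hdom : IntegrableOn (fun t => F 0 ^ (-e) * t ^ (-e)) (Ioc 0 t) :=
    ((intervalIntegrable_iff_integrableOn_Ioc_of_le ht).1
      (intervalIntegral.intervalIntegrable_rpow' (by linarith))).const_mul _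
  refine hdom.mono' (((continuousOn_integral_rpow hF hpos _).mono
    Ioc_subset_Ioi_self).aestronglyMeasurable measurableSet_Ioc)
    (ae_restrict_of_forall_mem measurableSet_Ioc fun s hs => ?_)
  have hle : F 0 * s ≤ ∫ τ in (0 : ℝ)..s, F τ := by
    have := intervalIntegral.integral_mono_on (μ := volume) (f := fun _ => F 0) hs.1.le
      intervalIntegrable_const (hF.intervalIntegrable 0 s)
      fun τ hτ => hmono hτ.1
    simpa [mul_comm] using this
  rw [Real.norm_of_nonneg (integral_rpow_nonneg hF hpos _ hs.1),
    ← Real.mul_rpow (hpos 0).le hs.1.le]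
  exact Real.rpow_le_rpow_of_nonpos (mul_pos (hpos 0) hs.1) hle (by linarith)

theorem integral_sub_abs_le (hF : Continuous F) (hF0 : ∀ s, 0 ≤ F s) (hmono : Monotone F)
    (ht : |A| ≤ t) : ∫ s in (0 : ℝ)..(t - |A|), F s ≤ ∫ s in (0 : ℝ)..t, F (A + s) := by
  have hFA : Continuous fun s => F (A + s) := hF.comp (by fun_prop)
  calc ∫ s in (0 : ℝ)..(t - |A|), F s
      ≤ ∫ s in (0 : ℝ)..(t - |A|), F (A + (s + |A|)) :=
        intervalIntegral.integral_mono_on (by linarith) (hF.intervalIntegrable _ _)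
          (Continuous.intervalIntegrable (by fun_prop) _ _)
          fun s _ => hmono (by linarith [neg_abs_le A])
    _ = ∫ s in |A|..t, F (A + s) := by
        rw [intervalIntegral.integral_comp_add_right (fun s => F (A + s))]
        simp
    _ ≤ (∫ s in (0 : ℝ)..|A|, F (A + s)) + ∫ s in |A|..t, F (A + s) :=
        le_add_of_nonneg_left
          (intervalIntegral.integral_nonneg (abs_nonneg A) fun s _ => hF0 _)
    _ = ∫ s in (0 : ℝ)..t, F (A + s) :=
        intervalIntegral.integral_add_adjacent_intervals (hFA.intervalIntegrable _ _)
          (hFA.intervalIntegrable _ _)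

theorem integrableOn_integral_rpow_comp_add (hF : Continuous F) (hpos : ∀ s, 0 < F s)
    (hmono : Monotone F) (he₀ : 0 ≤ e) (ht₀ : 0 < t₀)
    (hint : IntegrableOn (fun t => (∫ s in (0 : ℝ)..t, F s) ^ (-e)) (Ioi t₀)) (A : ℝ) :
    IntegrableOn (fun t => (∫ s in (0 : ℝ)..t, F (A + s)) ^ (-e)) (Ioi (t₀ + |A|)) := by
  have hFA : Continuous fun s => F (A + s) := hF.comp (by fun_prop)
  have hdom : IntegrableOn (fun t => (∫ s in (0 : ℝ)..(t - |A|), F s) ^ (-e))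
      (Ioi (t₀ + |A|)) := by
    have hpre := (measurePreserving_sub_right volume |A|).integrableOn_comp_preimage
      (MeasurableEquiv.subRight |A|).measurableEmbedding
      (f := fun t => (∫ s in (0 : ℝ)..t, F s) ^ (-e)) (s := Ioi t₀)
    rw [preimage_sub_const_Ioi] at hpre
    exact hpre.2 hint
  have hsub : Ioi (t₀ + |A|) ⊆ Ioi 0 := Ioi_subset_Ioi (by positivity)
  refine hdom.mono' (((continuousOn_integral_rpow hFA (fun s => hpos _) _).mono
    hsub).aestronglyMeasurable measurableSet_Ioi)
    (ae_restrict_of_forall_mem measurableSet_Ioi fun t ht => ?_)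
  have htA : t₀ < t - |A| := lt_sub_iff_add_lt.2 ht
  rw [Real.norm_of_nonneg (integral_rpow_nonneg hFA (fun s => hpos _) _ (hsub ht))]
  exact Real.rpow_le_rpow_of_nonpos (integral_pos_of_continuous hF hpos (ht₀.trans htA))
    (integral_sub_abs_le hF (fun s => (hpos s).le) hmono (by linarith)) (by linarith)

theorem integrableOn_of_not_kellerOsserman (hF : Continuous F) (hpos : ∀ s, 0 < F s)
    (hmono : Monotone F) (hq : 0 < q) (h : ¬ KellerOsserman F q) (A : ℝ) :
    IntegrableOn (fun t => (∫ s in (0 : ℝ)..t, F (A + s)) ^ (-(1 / (q + 1)))) (Ioi 0) := by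
  obtain ⟨t₀, ht₀, hint⟩ := (not_kellerOsserman_iff hF hpos).1 h
  have he₀ : 0 ≤ 1 / (q + 1) := by positivity
  have he₁ : 1 / (q + 1) < 1 := by rw [div_lt_one (by linarith)]; linarith
  have ht₁ : 0 ≤ t₀ + |A| := by positivity
  rw [← Ioc_union_Ioi_eq_Ioi ht₁]
  exact (integrableOn_Ioc_integral_rpow (hF.comp (by fun_prop)) (fun s => hpos _)
    (fun s t hst => hmono (by linarith)) he₀ he₁ ht₁).union
    (integrableOn_integral_rpow_comp_add hF hpos hmono he₀ ht₀ hint A)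

end Shift

/-! ### Necessity of the Keller–Osserman condition -/

/-- Primitive of `F` on `[A, ∞)`, extended by `0` below `A` so that it is nonnegative on the whole
line. -/
noncomputable def integralAbove (F : ℝ → ℝ) (A s : ℝ) : ℝ :=
  ∫ x in A..max s A, F x

section IntegralAbove

variable {F : ℝ → ℝ} {q B lam A A₁ s : ℝ}

theorem integralAbove_of_le (h : A ≤ s) : integralAbove F A s = ∫ x in A..s, F x := by
  rw [integralAbove, max_eq_left h]

@[simp]
theorem integralAbove_self : integralAbove F A A = 0 := by
  rw [integralAbove_of_le le_rfl, intervalIntegral.integral_same]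

theorem integralAbove_nonneg (hF0 : ∀ s, 0 ≤ F s) (A s : ℝ) : 0 ≤ integralAbove F A s :=
  intervalIntegral.integral_nonneg (le_max_right _ _) fun x _ => hF0 x

theorem continuous_integralAbove (hF : Continuous F) (A : ℝ) : Continuous (integralAbove F A) :=
  (continuous_integral_of_continuous hF A).comp (continuous_id.max continuous_const)

theorem hasDerivAt_integralAbove (hF : Continuous F) (hs : A < s) :
    HasDerivAt (integralAbove F A) (F s) s :=
  (hF.integral_hasStrictDerivAt A s).hasDerivAt.congr_of_eventuallyEq <| by
    filter_upwards [lt_mem_nhds hs] with t ht using integralAbove_of_le ht.le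

theorem integral_comp_add_le_integralAbove (hF : Continuous F) (hmono : Monotone F) (hA : A₁ ≤ A)
    {t : ℝ} (ht : 0 ≤ t) : ∫ x in (0 : ℝ)..t, F (A₁ + x) ≤ integralAbove F A (A + t) :=
  calc ∫ x in (0 : ℝ)..t, F (A₁ + x) ≤ ∫ x in (0 : ℝ)..t, F (A + x) :=
        intervalIntegral.integral_mono_on ht (Continuous.intervalIntegrable (by fun_prop) _ _)
          (Continuous.intervalIntegrable (by fun_prop) _ _) fun x _ => hmono (by linarith)
    _ = integralAbove F A (A + t) := by
        rw [integralAbove_of_le (by linarith), intervalIntegral.integral_comp_add_left, add_zero]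

/-- The bound does not depend on the initial slope `B`. -/
theorem climbTime_le (hF : Continuous F) (hpos : ∀ s, 0 < F s) (hmono : Monotone F) (hq : 0 < q)
    (hB : 0 < B) (hlam : 0 < lam) (hA : A₁ ≤ A) (hs : A ≤ s)
    (hint : IntegrableOn (fun t => (∫ x in (0 : ℝ)..t, F (A₁ + x)) ^ (-(1 / (q + 1)))) (Ioi 0)) :
    climbTime q B lam (integralAbove F A) A s ≤ lam ^ (-(1 / (q + 1))) *
      ∫ t in Ioi (0 : ℝ), (∫ x in (0 : ℝ)..t, F (A₁ + x)) ^ (-(1 / (q + 1))) := by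
  set e := 1 / (q + 1)
  have he0 : 0 < e := by positivity
  have hG := integralAbove_nonneg (fun s => (hpos s).le) A
  have hJ : ∀ t, 0 < t → 0 < ∫ x in (0 : ℝ)..t, F (A₁ + x) := fun t ht =>
    integral_pos_of_continuous (by fun_prop) (fun x => hpos _) ht
  have hpt : ∀ t, 0 < t → (profile q B lam (integralAbove F A) (A + t))⁻¹ ≤
      lam ^ (-e) * (∫ x in (0 : ℝ)..t, F (A₁ + x)) ^ (-e) := fun t ht => by
    rw [inv_profile_eq hq hB hlam.le hG, ← Real.mul_rpow hlam.le (hJ t ht).le]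
    refine Real.rpow_le_rpow_of_nonpos (mul_pos hlam (hJ t ht)) ?_ (by linarith)
    calc lam * ∫ x in (0 : ℝ)..t, F (A₁ + x) ≤ lam * integralAbove F A (A + t) := by
          gcongr
          exact integral_comp_add_le_integralAbove hF hmono hA ht.le
      _ ≤ lam * (1 + 1 / q) * integralAbove F A (A + t) := by
          have := hG (A + t)
          gcongr
          exact le_mul_of_one_le_right hlam.le (le_add_of_nonneg_right (by positivity))
      _ ≤ _ := le_add_of_nonneg_left (by positivity)
  have hshift : climbTime q B lam (integralAbove F A) A s =
      ∫ t in Ioc 0 (s - A), (profile q B lam (integralAbove F A) (A + t))⁻¹ := by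
    rw [← intervalIntegral.integral_of_le (sub_nonneg.2 hs), climbTime,
      intervalIntegral.integral_comp_add_left fun x => (profile q B lam (integralAbove F A) x)⁻¹]
    simp
  rw [hshift, ← integral_const_mul]
  refine (setIntegral_mono_on ?_ ((hint.mono_set Ioc_subset_Ioi_self).const_mul _)
    measurableSet_Ioc fun t ht => hpt t ht.1).trans
    (setIntegral_mono_set (hint.const_mul _) ?_ Ioc_subset_Ioi_self.eventuallyLE)
  · exact ((continuous_inv_profile hq hB hlam.le hG (continuous_integralAbove hF A)).comp
      (continuous_const_add A)).integrableOn_Ioc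
  · refine ae_restrict_of_forall_mem measurableSet_Ioi fun t ht => ?_
    have := hJ t ht
    simp only [Pi.zero_apply]
    positivity

theorem exists_lt_climbTime {G : ℝ → ℝ} {η δ : ℝ} (hq : 0 < q) (hB : 0 < B) (hlam : 0 ≤ lam)
    (hG : ∀ s, 0 ≤ G s) (hGc : Continuous G) (hGA : G A = 0) (hBη : B < η) (hδ : 0 < δ) :
    ∃ t ∈ Ioo 0 δ, t < climbTime q B lam G A (A + η * t) := by
  have hderiv : HasDerivAt (fun t => climbTime q B lam G A (A + η * t) - t) (B⁻¹ * η - 1) 0 := by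
    have hline : HasDerivAt (fun t : ℝ => A + η * t) η 0 := by
      simpa using ((hasDerivAt_id (0 : ℝ)).const_mul η).const_add A
    have hT := hasDerivAt_climbTime hq hB hlam hG hGc A A
    rw [profile_eq_of_eq_zero hq hB.le hGA] at hT
    exact (HasDerivAt.comp (h₂ := climbTime q B lam G A) 0 (by simpa using hT) hline).sub
      (hasDerivAt_id 0)
  have hslope : 0 < B⁻¹ * η - 1 := by
    rwa [sub_pos, ← div_eq_inv_mul, one_lt_div hB]
  obtain ⟨t, ht, htδ⟩ := ((eventually_pos_of_hasDerivAt_pos hderiv (by simp) hslope).and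
    (Ioo_mem_nhdsGT hδ)).exists
  exact ⟨t, htδ, sub_pos.1 ht⟩

end IntegralAbove

theorem exists_linear_growth {M : ℝ → ℝ} (hM : Continuous M) {a b : ℝ} (hab : a < b)
    (hlt : M a < M b) :
    ∃ η > 0, ∃ r ∈ Ico a b, ∀ t ∈ Icc r b, M r + η * (t - r) ≤ M t := by
  set η := (M b - M a) / (2 * (b - a)) with hη
  have hη0 : 0 < η := div_pos (by linarith) (by linarith)
  have hηb : η * (b - a) = (M b - M a) / 2 := by
    have : b - a ≠ 0 := by linarith
    rw [hη]
    field_simp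
  obtain ⟨r, hr, hmin⟩ := (isCompact_Icc (a := a) (b := b)).exists_isMinOn ⟨a, le_rfl, hab.le⟩
    (f := fun t => M t - η * t) (by fun_prop)
  have hra : M r - η * r ≤ M a - η * a := hmin ⟨le_rfl, hab.le⟩
  refine ⟨η, hη0, r, ⟨hr.1, lt_of_le_of_ne hr.2 fun h => ?_⟩, fun t ht => ?_⟩
  · rw [h] at hra
    nlinarith
  · have hrt : M r - η * r ≤ M t - η * t := hmin ⟨hr.1.trans ht.1, ht.2⟩
    linarith

theorem exists_one_le_rpow_mul_le {a c e : ℝ} (hc : 0 < c) (hae : (1 - a) * e < 1) (C : ℝ) :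
    ∃ ρ ≥ 1, (c * (4 * ρ) ^ (a - 1)) ^ (-e) * C ≤ ρ := by
  have hlim := (tendsto_rpow_neg_atTop (y := 1 - (1 - a) * e) (by linarith)).const_mul
    ((c * 4 ^ (a - 1)) ^ (-e) * C)
  rw [mul_zero] at hlim
  obtain ⟨ρ, hlt, hρ⟩ := ((hlim.eventually (gt_mem_nhds one_pos)).and
    (eventually_ge_atTop 1)).exists
  have hρ0 : 0 < ρ := by linarith
  have hpow : (c * (4 * ρ) ^ (a - 1)) ^ (-e) =
      (c * 4 ^ (a - 1)) ^ (-e) * (ρ ^ (-(1 - (1 - a) * e)) * ρ) := by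
    rw [← Real.rpow_add_one hρ0.ne', Real.mul_rpow (by norm_num) hρ0.le, ← mul_assoc,
      Real.mul_rpow (by positivity) (by positivity), ← Real.rpow_mul hρ0.le]
    congr 2
    ring
  refine ⟨ρ, hρ, ?_⟩
  rw [hpow]
  nlinarith

theorem exists_isLocalMax_annulus {n : ℕ} {u : Rn n → ℝ} (hu : Continuous u) {T : ℝ → ℝ}
    (hTc : Continuous T) (hT : StrictMono T) {r₀ ρ R : ℝ} (hr₀ : 0 < r₀)
    (hT₀ : T (sphereMax u r₀) = 0) (hTρ : ∀ s, T s ≤ ρ) (hR : r₀ + ρ ≤ R) {y : Rn n}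
    (hy : ‖y‖ ∈ Ioo r₀ R) (hyT : ‖y‖ - r₀ < T (u y)) :
    ∃ x, ‖x‖ ∈ Ioo r₀ R ∧ sphereMax u r₀ < u x ∧ IsLocalMax (fun z => T (u z) - ‖z‖) x := by
  have hcompact : IsCompact {x : Rn n | ‖x‖ ∈ Icc r₀ R} :=
    (isCompact_closedBall (0 : Rn n) R).of_isClosed_subset
      (isClosed_Icc.preimage continuous_norm) fun x hx => by simpa using hx.2
  obtain ⟨x, hx, hmax⟩ := hcompact.exists_isMaxOn ⟨y, Ioo_subset_Icc_self hy⟩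
    (f := fun z => T (u z) - ‖z‖) (by fun_prop)
  have hxT : ‖x‖ - r₀ < T (u x) := by
    have hyx : T (u y) - ‖y‖ ≤ T (u x) - ‖x‖ := hmax (Ioo_subset_Icc_self hy)
    linarith
  have hux : sphereMax u r₀ < u x := hT.lt_iff_lt.1 (by linarith [hx.1])
  have hinner : ‖x‖ ≠ r₀ := fun h =>
    hux.not_ge (h ▸ le_sphereMax hu (norm_pos_iff.1 (hr₀.trans_le hx.1)))
  have houter : ‖x‖ ≠ R := fun h => by linarith [hTρ (u x)]
  have hmem : ‖x‖ ∈ Ioo r₀ R := ⟨hx.1.lt_of_ne' hinner, hx.2.lt_of_ne houter⟩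
  refine ⟨x, hmem, hux, hmax.isLocalMax ?_⟩
  filter_upwards [continuous_norm.continuousAt.eventually (Ioo_mem_nhds hmem.1 hmem.2)] with z hz
    using Ioo_subset_Icc_self hz

theorem profile_rpow_div_le {q B lam : ℝ} {G F : ℝ → ℝ} (hq : 0 < q) (hB : 0 < B) (hlam : 0 < lam)
    (hG : ∀ s, 0 ≤ G s) (hGc : Continuous G) (hF0 : ∀ s, 0 ≤ F s) (hF : Monotone F) {A s r : ℝ}
    (hGd : ∀ s, A < s → HasDerivAt G (F s) s) (hGA : G A = 0) (hs : A ≤ s) (hr : 0 < r)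
    (hBr : B ^ q ≤ lam * F A * r) (hT : climbTime q B lam G A s ≤ r) :
    profile q B lam G s ^ q / r ≤ 2 * (lam * F s) := by
  rw [div_le_iff₀ hr]
  have hFs := hF0 s
  calc profile q B lam G s ^ q ≤ B ^ q + lam * F s * climbTime q B lam G A s :=
        profile_rpow_le hq hB hlam.le hG hGc hF hGd hGA hs
    _ ≤ lam * F s * r + lam * F s * r := by
        refine add_le_add (hBr.trans ?_) (by gcongr)
        gcongr
        exact hF hs
    _ = 2 * (lam * F s) * r := by ring

theorem exists_slope_lt {q η c : ℝ} (hq : 0 < q) (hη : 0 < η) (hc : 0 < c) :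
    ∃ B > 0, B < η ∧ B ^ q ≤ c := by
  refine ⟨min (η / 2) (c ^ q⁻¹), lt_min (half_pos hη) (by positivity),
    (min_le_left _ _).trans_lt (half_lt_self hη), ?_⟩
  calc min (η / 2) (c ^ q⁻¹) ^ q ≤ (c ^ q⁻¹) ^ q :=
        Real.rpow_le_rpow (by positivity) (min_le_right _ _) hq.le
    _ = c := Real.rpow_inv_rpow hc.le hq.ne'

namespace IsEntireSubsolution

variable {n k : ℕ} {p α β : ℝ} {f : ℝ → ℝ} {u : Rn n → ℝ}

theorem weight_le_of_isLocalMax (hk : 1 ≤ k) (hkn : k ≤ n) (hp : 1 < p) (hβ : β < p - 1)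
    (hf : ∀ t, 0 < f t) (hu : IsEntireSubsolution n k p α β f u) {q B lam A g : ℝ} {G : ℝ → ℝ}
    (hq : q = n * (p - β - 1) / k) (hB : 0 < B) (hlam : 0 ≤ lam) (hG : ∀ s, 0 ≤ G s)
    (hGc : Continuous G) {x : Rn n} (hx : x ≠ 0) (hGd : HasDerivAt G g (u x))
    (hmax : IsLocalMax (fun y => climbTime q B lam G A (u y) - ‖y‖) x) :
    ‖x‖ ^ (n * (α + 1) / k - 1) * f (u x) ^ ((n : ℝ) / k) ≤
      (k : ℝ) ^ (((n : ℝ) - k) / k) * ((p - 1) * (lam * g / q) +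
        ((k : ℝ) - 1) * (profile q B lam G (u x) ^ q / ‖x‖)) := by
  have hk₀ : (0 : ℝ) < k := by exact_mod_cast hk
  have hn₀ : (0 : ℝ) < n := by exact_mod_cast hk.trans hkn
  have hq₀ : 0 < q := hq ▸ div_pos (mul_pos hn₀ (by linarith)) hk₀
  set w := profile q B lam G (u x) with hw_def
  have hw : 0 < w := profile_pos hq₀ hB hlam hG _
  have hxn : 0 < ‖x‖ := norm_pos_iff.2 hx
  set w₁ := lam * g / (q * w ^ q) with hw₁
  obtain ⟨-, -, mu, hmu, hcone, hineq⟩ := hu.subsolution x hx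
  obtain ⟨hgrad, j, hj⟩ := exists_le_spike_of_isLocalMax (w := w) hp hx (hu.contDiffAt hx)
    (Eventually.of_forall (hasDerivAt_climbTime hq₀ hB hlam hG hGc A))
    ((hasDerivAt_profile hq₀ hB hlam hG hGd).inv hw.ne') (inv_pos.2 hw) hw.ne'
    (by simpa only [← hw_def, inv_mul_cancel₀ hw.ne', one_mul] using hmax) hmu
  have hpow : w ^ (p - 1) = w ^ (p - 2) * w := by
    rw [← Real.rpow_add_one hw.ne']
    ring_nf
  have hd₁ : (p - 1) * |w| ^ (p - 2) * (-(-w₁ / w ^ 2) * w ^ 2 / w⁻¹) =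
      w ^ (p - 1) * ((p - 1) * w₁) := by
    rw [hpow, abs_of_pos hw]
    field_simp
  have hd₂ : |w| ^ (p - 2) * (w / ‖x‖) = w ^ (p - 1) / ‖x‖ := by
    rw [hpow, abs_of_pos hw]
    ring
  rw [← hw_def, ← hw₁, hd₁, hd₂] at hj
  rw [hgrad, abs_of_pos hw] at hineq
  have hκ : 0 < (p - 1) * w₁ + ((k : ℝ) - 1) / ‖x‖ := by
    have := pos_of_spike_mem_coneP hk hkn (isUpperSet_coneP hj hcone)
    refine pos_of_mul_pos_right (a := w ^ (p - 1)) (this.trans_eq ?_) (by positivity)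
    ring
  have hmain := (weight_le_PiK_spike_iff hk hkn j hxn hw (hf (u x)) hκ).1
    (hineq.trans (Real.rpow_le_rpow (PiK_pos hcone).le (PiK_mono hcone hj) (by positivity)))
  refine hmain.trans_eq ?_
  rw [← hq, hw₁]
  field_simp

theorem exists_isLocalMax_climbTime (hk : 1 ≤ k) (hkn : k ≤ n) (hp : 1 < p)
    (hu : IsEntireSubsolution n k p α β f u) {F : ℝ → ℝ} (hF : Continuous F)
    (hpos : ∀ s, 0 < F s) {q ρ lam : ℝ} (hq : 0 < q) (hρ : 1 ≤ ρ) (hlam : 0 < lam)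
    (hclimb : ∀ A B s, sphereMax u 1 ≤ A → 0 < B → A ≤ s →
      climbTime q B lam (integralAbove F A) A s ≤ ρ) :
    ∃ A B : ℝ, ∃ x : Rn n, 0 < B ∧ B ^ q ≤ lam * F A * ρ ∧ ‖x‖ ∈ Ioo ρ (4 * ρ) ∧ A < u x ∧
      climbTime q B lam (integralAbove F A) A (u x) ≤ ρ ∧
      IsLocalMax (fun z => climbTime q B lam (integralAbove F A) A (u z) - ‖z‖) x := by
  have : Nonempty (Fin n) := ⟨⟨0, hk.trans hkn⟩⟩
  have huc := hu.contDiff_one.continuous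
  obtain ⟨η, hη, r₀, ⟨hρr₀, hr₀ρ⟩, hgrow⟩ := exists_linear_growth (continuous_sphereMax huc)
    (show ρ < 2 * ρ by linarith) (hu.sphereMax_lt hk hkn hp (by linarith) (by linarith))
  set A := sphereMax u r₀ with hA
  have hA₁ : sphereMax u 1 ≤ A := by
    obtain h | h := (hρ.trans hρr₀).eq_or_lt
    · rw [hA, h]
    · exact hu.sphereMax_le hk hkn hp one_pos h
  obtain ⟨B, hB, hBη, hBq⟩ := exists_slope_lt hq hη
    (mul_pos (mul_pos hlam (hpos A)) (by linarith : 0 < ρ))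
  have hG := integralAbove_nonneg (fun s => (hpos s).le) A
  have hGc := continuous_integralAbove hF A
  have hTmono := strictMono_climbTime hq hB hlam.le hG hGc A
  have hTle : ∀ s, climbTime q B lam (integralAbove F A) A s ≤ ρ := fun s =>
    (hTmono.monotone (le_max_left s A)).trans (hclimb A B _ hA₁ hB (le_max_right s A))
  obtain ⟨t, ⟨ht₀, htρ⟩, htT⟩ := exists_lt_climbTime hq hB hlam.le hG hGc integralAbove_self hBη
    (sub_pos.2 hr₀ρ)
  obtain ⟨y, hy, hyM⟩ := exists_eq_sphereMax huc (r := r₀ + t) (by linarith)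
  have hyT : ‖y‖ - r₀ < climbTime q B lam (integralAbove F A) A (u y) := by
    have hle := hgrow (r₀ + t) ⟨by linarith, by linarith⟩
    rw [add_sub_cancel_left, ← hyM] at hle
    rw [hy, add_sub_cancel_left]
    exact htT.trans_le (hTmono.monotone hle)
  obtain ⟨x, ⟨hx₁, hx₂⟩, hux, hloc⟩ := exists_isLocalMax_annulus huc
    (continuous_climbTime hq hB hlam.le hG hGc A) hTmono (R := 4 * ρ) (by linarith)
    (climbTime_self A) hTle (by linarith) (by rw [hy]; constructor <;> linarith) hyT
  exact ⟨A, B, x, hB, hBq, ⟨by linarith, hx₂⟩, hux, hTle _, hloc⟩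

theorem exists_norm_rpow_le (hk : 1 ≤ k) (hkn : k ≤ n) (hp : 1 < p) (hβ : β < p - 1)
    (hf : ∀ t, 0 < f t) (hfm : Monotone f) (hfc : Continuous f)
    (hu : IsEntireSubsolution n k p α β f u) {F : ℝ → ℝ} {q ρ lam : ℝ}
    (hF : F = fun s => f s ^ ((n : ℝ) / k)) (hq : q = n * (p - β - 1) / k) (hρ : 1 ≤ ρ)
    (hlam : 0 < lam)
    (hclimb : ∀ A B s, sphereMax u 1 ≤ A → 0 < B → A ≤ s →
      climbTime q B lam (integralAbove F A) A s ≤ ρ) :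
    ∃ x : Rn n, ‖x‖ ∈ Ioo ρ (4 * ρ) ∧ ‖x‖ ^ (n * (α + 1) / k - 1) ≤
      (k : ℝ) ^ (((n : ℝ) - k) / k) * ((p - 1) / q + 2 * ((k : ℝ) - 1)) * lam := by
  have hk₁ : (1 : ℝ) ≤ k := by exact_mod_cast hk
  have hn₀ : (0 : ℝ) < n := by exact_mod_cast hk.trans hkn
  have hq₀ : 0 < q := hq ▸ div_pos (mul_pos hn₀ (by linarith)) (by linarith)
  have hFc : Continuous F := hF ▸ hfc.rpow_const fun s => Or.inl (hf s).ne'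
  have hFpos : ∀ s, 0 < F s := fun s => hF ▸ Real.rpow_pos_of_pos (hf s) _
  have hFm : Monotone F := hF ▸ fun s t hst =>
    Real.rpow_le_rpow (hf s).le (hfm hst) (by positivity)
  obtain ⟨A, B, x, hB, hBq, hxρ, hux, hT, hloc⟩ :=
    hu.exists_isLocalMax_climbTime hk hkn hp hFc hFpos hq₀ hρ hlam hclimb
  have hx : 0 < ‖x‖ := by linarith [hxρ.1]
  have hG := integralAbove_nonneg (fun s => (hFpos s).le) A
  have hGc := continuous_integralAbove hFc A
  have hGd : ∀ s, A < s → HasDerivAt (integralAbove F A) (F s) s := fun s hs =>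
    hasDerivAt_integralAbove hFc hs
  have hweight := hu.weight_le_of_isLocalMax hk hkn hp hβ hf hq hB hlam.le hG hGc
    (norm_pos_iff.1 hx) (hGd _ hux) hloc
  have hBx : B ^ q ≤ lam * F A * ‖x‖ :=
    hBq.trans (mul_le_mul_of_nonneg_left hxρ.1.le (mul_pos hlam (hFpos A)).le)
  have hprofile := mul_le_mul_of_nonneg_left (profile_rpow_div_le hq₀ hB hlam hG hGc
    (fun s => (hFpos s).le) hFm hGd integralAbove_self hux.le hx hBx (hT.trans hxρ.1.le))
    (sub_nonneg.2 hk₁)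
  refine ⟨x, hxρ, le_of_mul_le_mul_right ?_ (hFpos (u x))⟩
  rw [← congrFun hF (u x)] at hweight
  calc ‖x‖ ^ (n * (α + 1) / k - 1) * F (u x) ≤ _ := hweight
    _ ≤ (k : ℝ) ^ (((n : ℝ) - k) / k) *
          ((p - 1) * (lam * F (u x) / q) + ((k : ℝ) - 1) * (2 * (lam * F (u x)))) := by gcongr
    _ = _ := by ring

theorem kellerOsserman (hk : 1 ≤ k) (hkn : k ≤ n) (hα : -1 < α) (hp : 1 < p) (hβ : β < p - 1)
    (hf : ∀ t, 0 < f t) (hfm : Monotone f) (hfc : Continuous f)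
    (hu : IsEntireSubsolution n k p α β f u) :
    KellerOsserman (fun s => f s ^ ((n : ℝ) / k)) (n * (p - β - 1) / k) := by
  by_contra hKO
  have hk₁ : (1 : ℝ) ≤ k := by exact_mod_cast hk
  have hn₀ : (0 : ℝ) < n := by exact_mod_cast hk.trans hkn
  set F : ℝ → ℝ := fun s => f s ^ ((n : ℝ) / k) with hF
  set q := n * (p - β - 1) / k with hq
  have hq₀ : 0 < q := div_pos (mul_pos hn₀ (by linarith)) (by linarith)
  have hFc : Continuous F := hfc.rpow_const fun s => Or.inl (hf s).ne'
  have hFpos : ∀ s, 0 < F s := fun s => Real.rpow_pos_of_pos (hf s) _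
  have hFm : Monotone F := fun s t hst =>
    Real.rpow_le_rpow (hf s).le (hfm hst) (by positivity)
  have hint := integrableOn_of_not_kellerOsserman hFc hFpos hFm hq₀ hKO (sphereMax u 1)
  set a := min (n * (α + 1) / k) 1
  have ha₀ : 0 < a := lt_min (div_pos (mul_pos hn₀ (by linarith)) (by linarith)) one_pos
  set D := (k : ℝ) ^ (((n : ℝ) - k) / k) * ((p - 1) / q + 2 * ((k : ℝ) - 1))
  have hD : 0 < D := mul_pos (by positivity)
    (add_pos_of_pos_of_nonneg (div_pos (by linarith) hq₀) (by linarith))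
  have hae : (1 - a) * (1 / (q + 1)) < 1 := by
    rw [mul_one_div, div_lt_one (by linarith)]
    linarith
  obtain ⟨ρ, hρ, hclimb⟩ := exists_one_le_rpow_mul_le (c := 1 / (2 * D)) (by positivity) hae
    (∫ t in Ioi (0 : ℝ), (∫ x in (0 : ℝ)..t, F (sphereMax u 1 + x)) ^ (-(1 / (q + 1))))
  have hlam : 0 < 1 / (2 * D) * (4 * ρ) ^ (a - 1) := by positivity
  obtain ⟨x, ⟨hρx, hxρ⟩, hx⟩ := hu.exists_norm_rpow_le hk hkn hp hβ hf hfm hfc hF hq hρ hlam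
    fun A B s hA hB hs => (climbTime_le hFc hFpos hFm hq₀ hB hlam hA hs hint).trans hclimb
  have hchain : (4 * ρ) ^ (a - 1) ≤ (4 * ρ) ^ (a - 1) / 2 :=
    calc (4 * ρ) ^ (a - 1) ≤ ‖x‖ ^ (a - 1) :=
          Real.rpow_le_rpow_of_nonpos (by linarith) hxρ.le (sub_nonpos.2 (min_le_right _ _))
      _ ≤ ‖x‖ ^ (n * (α + 1) / k - 1) :=
          Real.rpow_le_rpow_of_exponent_le (hρ.trans hρx.le) (sub_le_sub_right (min_le_left _ _) 1)
      _ ≤ D * (1 / (2 * D) * (4 * ρ) ^ (a - 1)) := hx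
      _ = (4 * ρ) ^ (a - 1) / 2 := by field_simp
  have : 0 < (4 * ρ) ^ (a - 1) := by positivity
  linarith

end IsEntireSubsolution

/-! ### Radial solutions under the Keller–Osserman condition -/

section GlobalSolution

variable {F G : ℝ → ℝ} {q B lam A s : ℝ}

theorem climbTime_of_nonpos (hq : 0 < q) (hB : 0 ≤ B) (hG₀ : ∀ s ≤ 0, G s = 0) (hA : A ≤ 0)
    (hs : s ≤ 0) : climbTime q B lam G A s = (s - A) * B⁻¹ :=
  calc climbTime q B lam G A s = ∫ _ in A..s, B⁻¹ :=
        intervalIntegral.integral_congr fun x hx => by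
          simp only [profile_eq_of_eq_zero hq hB (hG₀ x (hx.2.trans (max_le hA hs)))]
    _ = (s - A) * B⁻¹ := by rw [intervalIntegral.integral_const, smul_eq_mul]

theorem rpow_mul_rpow_le_inv_profile (hF : Continuous F) (hpos : ∀ s, 0 < F s) (hq : 0 < q)
    (hB : 0 < B) (hlam : 0 ≤ lam) (hG : ∀ s, 0 ≤ G s) (hs : 1 ≤ s)
    (hGF : G s ≤ ∫ x in (0 : ℝ)..s, F x) :
    (B ^ (q + 1) / (∫ x in (0 : ℝ)..1, F x) + lam * (1 + 1 / q)) ^ (-(1 / (q + 1))) *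
        (∫ x in (0 : ℝ)..s, F x) ^ (-(1 / (q + 1))) ≤ (profile q B lam G s)⁻¹ := by
  set I : ℝ → ℝ := fun t => ∫ x in (0 : ℝ)..t, F x
  have hI₁ : 0 < I 1 := integral_pos_of_continuous hF hpos one_pos
  have hIs : I 1 ≤ I s := monotone_integral_of_nonneg hF (fun x => (hpos x).le) 0 hs
  rw [inv_profile_eq hq hB hlam hG, ← Real.mul_rpow (by positivity) (hI₁.trans_le hIs).le]
  refine Real.rpow_le_rpow_of_nonpos (profile_base_pos hq hB hlam hG s) ?_
    (neg_nonpos.2 (by positivity))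
  calc B ^ (q + 1) + lam * (1 + 1 / q) * G s
      ≤ B ^ (q + 1) / I 1 * I s + lam * (1 + 1 / q) * I s := by
        gcongr
        rw [div_mul_eq_mul_div, le_div_iff₀ hI₁]
        gcongr
    _ = (B ^ (q + 1) / I 1 + lam * (1 + 1 / q)) * I s := by ring

theorem exists_climbTime_gt (hF : Continuous F) (hpos : ∀ s, 0 < F s) (hq : 0 < q) (hB : 0 < B)
    (hlam : 0 ≤ lam) (hG : ∀ s, 0 ≤ G s) (hGc : Continuous G)
    (hGF : ∀ s, 0 ≤ s → G s ≤ ∫ x in (0 : ℝ)..s, F x) (hKO : KellerOsserman F q) (A M : ℝ) :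
    ∃ s, M < climbTime q B lam G A s := by
  set I : ℝ → ℝ := fun t => ∫ x in (0 : ℝ)..t, F x
  have hI₁ : 0 < I 1 := integral_pos_of_continuous hF hpos one_pos
  set c := (B ^ (q + 1) / I 1 + lam * (1 + 1 / q)) ^ (-(1 / (q + 1)))
  have hc : 0 < c := by positivity
  have hint : ∀ a b, IntervalIntegrable (fun x => (profile q B lam G x)⁻¹) volume a b :=
    (continuous_inv_profile hq hB hlam hG hGc).intervalIntegrable
  obtain ⟨s, hs, hM⟩ := hKO.exists_integral_gt hF hpos ((M - climbTime q B lam G A 1) / c)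
  rw [div_lt_iff₀ hc, mul_comm, ← intervalIntegral.integral_const_mul] at hM
  refine ⟨s, ?_⟩
  calc M < climbTime q B lam G A 1 + ∫ x in (1 : ℝ)..s, c * I x ^ (-(1 / (q + 1))) := by linarith
    _ ≤ climbTime q B lam G A 1 + ∫ x in (1 : ℝ)..s, (profile q B lam G x)⁻¹ := by
        gcongr
        refine intervalIntegral.integral_mono_on hs.le ?_ (hint _ _) fun x hx =>
          rpow_mul_rpow_le_inv_profile hF hpos hq hB hlam hG hx.1 (hGF x (by linarith [hx.1]))
        refine ContinuousOn.intervalIntegrable ?_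
        rw [uIcc_of_le hs.le]
        exact ((continuousOn_integral_rpow hF hpos _).mono fun x hx =>
          one_pos.trans_le hx.1).const_mul _
    _ = climbTime q B lam G A s :=
        intervalIntegral.integral_add_adjacent_intervals (hint _ _) (hint _ _)

theorem surjective_climbTime (hF : Continuous F) (hpos : ∀ s, 0 < F s) (hq : 0 < q) (hB : 0 < B)
    (hlam : 0 ≤ lam) (hG : ∀ s, 0 ≤ G s) (hGc : Continuous G) (hG₀ : ∀ s ≤ 0, G s = 0)
    (hGF : ∀ s, 0 ≤ s → G s ≤ ∫ x in (0 : ℝ)..s, F x) (hKO : KellerOsserman F q) (hA : A ≤ 0) :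
    Function.Surjective (climbTime q B lam G A) := fun M => by
  obtain ⟨s, hs⟩ := exists_climbTime_gt hF hpos hq hB hlam hG hGc hGF hKO A M
  refine mem_range_of_exists_le_of_exists_ge (continuous_climbTime hq hB hlam hG hGc A)
    ⟨min 0 (A + B * M), ?_⟩ ⟨s, hs.le⟩
  rw [climbTime_of_nonpos hq hB.le hG₀ hA (min_le_left _ _), ← div_eq_mul_inv, div_le_iff₀' hB]
  linarith [min_le_right 0 (A + B * M)]

theorem exists_global_solution (hF : Continuous F) (hpos : ∀ s, 0 < F s) (hq : 0 < q) (hB : 0 < B)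
    (hlam : 0 ≤ lam) (hG : ∀ s, 0 ≤ G s) (hGc : Continuous G) (hG₀ : ∀ s ≤ 0, G s = 0)
    (hGF : ∀ s, 0 ≤ s → G s ≤ ∫ x in (0 : ℝ)..s, F x) (hKO : KellerOsserman F q) (hA : A ≤ 0) :
    ∃ Y : ℝ → ℝ, (∀ t, HasDerivAt Y (profile q B lam G (Y t)) t) ∧
      ∀ t, 0 < Y t → -A / B < t := by
  have hmono := strictMono_climbTime hq hB hlam hG hGc A
  set E := hmono.orderIsoOfSurjective _
    (surjective_climbTime hF hpos hq hB hlam hG hGc hG₀ hGF hKO hA)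
  have hE : ∀ t, climbTime q B lam G A (E.symm t) = t := E.apply_symm_apply
  refine ⟨E.symm, fun t => ?_, fun t ht => ?_⟩
  · have hinv := HasDerivAt.of_local_left_inverse E.symm.continuous.continuousAt
      (hasDerivAt_climbTime hq hB hlam hG hGc A (E.symm t))
      (inv_ne_zero (profile_pos hq hB hlam hG _).ne') (Eventually.of_forall hE)
    rwa [inv_inv] at hinv
  · have hlt := hmono ht
    rwa [hE, climbTime_of_nonpos hq hB.le hG₀ hA le_rfl, zero_sub, ← div_eq_mul_inv] at hlt

end GlobalSolution

/-- Excess of `F` over `F 0` on `[0, ∞)`, and `0` on `(-∞, 0]`. -/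
noncomputable def excess (F : ℝ → ℝ) (s : ℝ) : ℝ :=
  F (max s 0) - F 0

section Excess

variable {F : ℝ → ℝ} {s : ℝ}

theorem excess_of_nonneg (hs : 0 ≤ s) : excess F s = F s - F 0 := by
  rw [excess, max_eq_left hs]

theorem excess_of_nonpos (hs : s ≤ 0) : excess F s = 0 := by
  rw [excess, max_eq_right hs, sub_self]

theorem continuous_excess (hF : Continuous F) : Continuous (excess F) :=
  (hF.comp (continuous_id.max continuous_const)).sub continuous_const

theorem excess_nonneg (hF : Monotone F) (s : ℝ) : 0 ≤ excess F s :=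
  sub_nonneg.2 (hF (le_max_right _ _))

theorem integral_excess_of_nonpos (hs : s ≤ 0) : ∫ x in (0 : ℝ)..s, excess F x = 0 :=
  intervalIntegral.integral_zero_ae <| Eventually.of_forall fun x hx => by
    rw [uIoc_of_ge hs] at hx
    exact excess_of_nonpos hx.2

theorem integral_excess_nonneg (hF : Monotone F) (s : ℝ) : 0 ≤ ∫ x in (0 : ℝ)..s, excess F x := by
  obtain hs | hs := le_total s 0
  · rw [integral_excess_of_nonpos hs]
  · exact intervalIntegral.integral_nonneg hs fun x _ => excess_nonneg hF x

theorem integral_excess_le (hF : Continuous F) (hF₀ : 0 ≤ F 0) (hs : 0 ≤ s) :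
    ∫ x in (0 : ℝ)..s, excess F x ≤ ∫ x in (0 : ℝ)..s, F x :=
  intervalIntegral.integral_mono_on hs ((continuous_excess hF).intervalIntegrable _ _)
    (hF.intervalIntegrable _ _) fun x hx => by
      rw [excess_of_nonneg hx.1]
      linarith

end Excess

section RadialProfile

variable {p q a m r y : ℝ}

/-- For `u x = Y (‖x‖ ^ m)`, with `m - 1 = a / q`, the radial operator splits into a term that
bounds `F 0` and a term that bounds the excess of `F`. -/
theorem radial_operator_eq (hq : 0 < q) (hm : 1 < m) (hmq : (m - 1) * q = a) (hr : 0 < r)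
    (hy : 0 < y) (lam E : ℝ) :
    (p - 1) * (m * r ^ (m - 1) * y) ^ (q - 1) *
        (m * (m - 1) * r ^ (m - 2) * y + m ^ 2 * r ^ (2 * m - 2) * (lam * E / (q * y ^ q) * y)) =
      (p - 1) / q * r ^ (a - 1) * (a * m ^ q * y ^ q + m ^ (q + 1) * lam * r ^ m * E) := by
  have hm₀ : 0 < m := by linarith
  have hpow : (m * r ^ (m - 1) * y) ^ (q - 1) = m ^ q / m * r ^ (a - (m - 1)) * (y ^ q / y) := by
    rw [Real.mul_rpow (by positivity) hy.le, Real.mul_rpow hm₀.le (by positivity),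
      ← Real.rpow_mul hr.le, Real.rpow_sub_one hm₀.ne', Real.rpow_sub_one hy.ne', mul_sub_one, hmq]
  have hr₁ : r ^ (a - (m - 1)) * r ^ (m - 2) = r ^ (a - 1) := by
    rw [← Real.rpow_add hr]
    ring_nf
  have hr₂ : r ^ (a - (m - 1)) * r ^ (2 * m - 2) = r ^ (a - 1) * r ^ m := by
    rw [← Real.rpow_add hr, ← Real.rpow_add hr]
    ring_nf
  rw [hpow, Real.rpow_add_one hm₀.ne' q]
  calc _ = (p - 1) * m ^ q * (m - 1) * y ^ q * (r ^ (a - (m - 1)) * r ^ (m - 2)) +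
        (p - 1) * m ^ q * m * lam * E / q * (r ^ (a - (m - 1)) * r ^ (2 * m - 2)) := by
        field_simp
    _ = _ := by
        rw [hr₁, hr₂, ← hmq]
        field_simp

theorem mul_sub_le_excess {F : ℝ → ℝ} (hF : Monotone F) {c B s z : ℝ} (hc : 0 ≤ c) (hB : 0 < B)
    (hs : 0 < s → 1 / B < z) : c * (F s - F 0) ≤ c * B * z * excess F s := by
  obtain h | h := le_or_gt s 0
  · calc c * (F s - F 0) ≤ 0 := mul_nonpos_of_nonneg_of_nonpos hc (sub_nonpos.2 (hF h))
      _ = c * B * z * excess F s := by rw [excess_of_nonpos h, mul_zero]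
  · have hBz : 1 ≤ B * z := ((div_lt_iff₀' hB).1 (hs h)).le
    rw [excess_of_nonneg h.le, mul_assoc c]
    exact mul_le_mul_of_nonneg_right (le_mul_of_one_le_right hc hBz) (sub_nonneg.2 (hF h.le))

theorem contDiff_two_of_hasDerivAt {Y Y₁ Y₂ : ℝ → ℝ} (hY : ∀ t, HasDerivAt Y (Y₁ t) t)
    (hY₁ : ∀ t, HasDerivAt Y₁ (Y₂ t) t) (hY₂ : Continuous Y₂) : ContDiff ℝ 2 Y := by
  have hderiv : deriv Y = Y₁ := funext fun t => (hY t).deriv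
  have hderiv₁ : deriv Y₁ = Y₂ := funext fun t => (hY₁ t).deriv
  refine contDiff_succ_iff_deriv (n := 1).2 ⟨fun t => (hY t).differentiableAt, by simp, ?_⟩
  rw [hderiv, contDiff_one_iff_deriv, hderiv₁]
  exact ⟨fun t => (hY₁ t).differentiableAt, hY₂⟩

theorem exists_contDiff_excess_solution {F : ℝ → ℝ} (hF : Continuous F) (hpos : ∀ t, 0 < F t)
    (hmono : Monotone F) {B lam : ℝ} (hq : 0 < q) (hB : 0 < B) (hlam : 0 ≤ lam)
    (hKO : KellerOsserman F q) :
    ∃ Y : ℝ → ℝ, ContDiff ℝ 2 Y ∧ (∀ t, B ≤ deriv Y t) ∧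
      (∀ t, deriv (deriv Y) t = lam * excess F (Y t) / (q * deriv Y t ^ q) * deriv Y t) ∧
      ∀ t, 0 < Y t → 1 / B < t := by
  have hE := continuous_excess hF
  set G : ℝ → ℝ := fun s => ∫ x in (0 : ℝ)..s, excess F x
  have hG : ∀ s, 0 ≤ G s := integral_excess_nonneg hmono
  have hGc : Continuous G := continuous_integral_of_continuous hE 0
  have hGd : ∀ s, HasDerivAt G (excess F s) s := fun s =>
    (hE.integral_hasStrictDerivAt 0 s).hasDerivAt
  obtain ⟨Y, hY, hYB⟩ := exists_global_solution (A := -1) hF hpos hq hB hlam hG hGc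
    (fun s => integral_excess_of_nonpos) (fun s => integral_excess_le hF (hpos 0).le) hKO
    (by norm_num)
  set Φ := profile q B lam G
  have hΦ : ∀ s, 0 < Φ s := profile_pos hq hB hlam hG
  have hderiv : deriv Y = fun t => Φ (Y t) := funext fun t => (hY t).deriv
  have hΦY : ∀ t, HasDerivAt (fun t => Φ (Y t))
      (lam * excess F (Y t) / (q * Φ (Y t) ^ q) * Φ (Y t)) t := fun t =>
    (hasDerivAt_profile hq hB hlam hG (hGd _)).comp t (hY t)
  have hYc : Continuous Y := continuous_iff_continuousAt.2 fun t => (hY t).continuousAt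
  have hΦYc : Continuous fun t => Φ (Y t) := (continuous_profile hq hB hlam hG hGc).comp hYc
  have hcont : Continuous fun t => lam * excess F (Y t) / (q * Φ (Y t) ^ q) * Φ (Y t) :=
    (((hE.comp hYc).const_mul _).div
      ((hΦYc.rpow_const fun t => Or.inl (hΦ _).ne').const_mul _)
      fun t => (mul_pos hq (Real.rpow_pos_of_pos (hΦ _) _)).ne').mul hΦYc
  refine ⟨Y, contDiff_two_of_hasDerivAt hY hΦY hcont, ?_, ?_, by simpa using hYB⟩
  · simpa only [hderiv] using fun t => le_profile hq hB.le hlam (hG _)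
  · simpa only [hderiv] using fun t => (hΦY t).deriv

theorem exists_radial_profile {F : ℝ → ℝ} (hF : Continuous F) (hpos : ∀ t, 0 < F t)
    (hmono : Monotone F) (hp : 1 < p) (hq : 0 < q) (hm : 1 < m) (hmq : (m - 1) * q = a)
    (hKO : KellerOsserman F q) :
    ∃ Y : ℝ → ℝ, ContDiff ℝ 2 Y ∧ (∀ t, 0 < deriv Y t) ∧
      ∀ r, 0 < r → r ^ (a - 1) * F (Y (r ^ m)) ≤
        (p - 1) * (m * r ^ (m - 1) * deriv Y (r ^ m)) ^ (q - 1) *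
          (m * (m - 1) * r ^ (m - 2) * deriv Y (r ^ m) +
            m ^ 2 * r ^ (2 * m - 2) * deriv (deriv Y) (r ^ m)) := by
  have hp₁ : 0 < p - 1 := by linarith
  have ha : 0 < a := hmq ▸ mul_pos (by linarith) hq
  have hF₀ := hpos 0
  have : 0 < m := by linarith
  set B := (q / (p - 1) * F 0 / (a * m ^ q)) ^ q⁻¹ with hB_def
  have hB : 0 < B := by positivity
  have hBq : a * m ^ q * B ^ q = q / (p - 1) * F 0 := by
    rw [hB_def, Real.rpow_inv_rpow (by positivity) hq.ne']
    field_simp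
  set lam := q / (p - 1) * B / m ^ (q + 1) with hlam_def
  have hlam : 0 ≤ lam := by positivity
  have hlamB : m ^ (q + 1) * lam = q / (p - 1) * B := by rw [hlam_def]; field_simp
  obtain ⟨Y, hY, hY₁, hY₂, hYB⟩ :=
    exists_contDiff_excess_solution hF hpos hmono hq hB hlam hKO
  have hY₁pos : ∀ t, 0 < deriv Y t := fun t => hB.trans_le (hY₁ t)
  refine ⟨Y, hY, hY₁pos, fun r hr => ?_⟩
  rw [hY₂, radial_operator_eq hq hm hmq hr (hY₁pos _), hlamB]
  have hzero : q / (p - 1) * F 0 ≤ a * m ^ q * deriv Y (r ^ m) ^ q := by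
    rw [← hBq]
    gcongr
    exact hY₁ _
  have hexcess := mul_sub_le_excess hmono (c := q / (p - 1)) (by positivity) hB (hYB (r ^ m))
  calc r ^ (a - 1) * F (Y (r ^ m)) = (p - 1) / q * r ^ (a - 1) *
        (q / (p - 1) * F 0 + q / (p - 1) * (F (Y (r ^ m)) - F 0)) := by field_simp; ring
    _ ≤ _ := by gcongr

end RadialProfile

section NormRpowRegularity

variable {E : Type*} [NormedAddCommGroup E] [InnerProductSpace ℝ E] {m : ℝ}

theorem norm_axial_le {ν : E} (hν : ‖ν‖ ≤ 1) (d₁ d₂ : ℝ) :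
    ‖axial ν d₁ d₂‖ ≤ |d₂| + |d₁ - d₂| := by
  refine ContinuousLinearMap.opNorm_le_bound _ (by positivity) fun h => ?_
  have hinner : |⟪ν, h⟫| ≤ ‖h‖ :=
    (abs_real_inner_le_norm ν h).trans (mul_le_of_le_one_left (norm_nonneg h) hν)
  calc ‖axial ν d₁ d₂ h‖ ≤ |d₂| * ‖h‖ + |d₁ - d₂| * |⟪ν, h⟫| * ‖ν‖ := by
        rw [axial_apply]
        refine (norm_add_le _ _).trans_eq ?_
        rw [norm_smul, norm_smul, Real.norm_eq_abs, Real.norm_eq_abs, abs_mul]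
    _ ≤ |d₂| * ‖h‖ + |d₁ - d₂| * ‖h‖ * 1 := by gcongr
    _ = (|d₂| + |d₁ - d₂|) * ‖h‖ := by ring

theorem norm_inv_norm_smul_le_one (x : E) : ‖‖x‖⁻¹ • x‖ ≤ 1 := by
  rw [norm_smul, norm_inv, norm_norm]
  exact inv_mul_le_one

theorem hasFDerivAt_norm_rpow_smul_zero (hm : 2 < m) :
    HasFDerivAt (fun x : E => ‖x‖ ^ (m - 2) • x) (0 : E →L[ℝ] E) 0 := by
  have hpow : (fun x : E => ‖x‖ ^ (m - 2)) =o[𝓝 0] fun _ => (1 : ℝ) := by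
    rw [Asymptotics.isLittleO_one_iff]
    have h := ((continuous_norm (E := E)).rpow_const (p := m - 2)
      fun _ => Or.inr (by linarith)).tendsto 0
    rwa [norm_zero, Real.zero_rpow (by linarith)] at h
  rw [hasFDerivAt_iff_isLittleO_nhds_zero]
  simpa using hpow.smul_isBigO (Asymptotics.isBigO_refl (fun x : E => x) (𝓝 0))

theorem contDiff_norm_rpow_smul (hm : 2 ≤ m) : ContDiff ℝ 1 (fun x : E => ‖x‖ ^ (m - 2) • x) := by
  obtain rfl | hm := hm.eq_or_lt
  · simpa using! contDiff_id
  have hzero : (0 : ℝ) ^ (m - 2) = 0 := Real.zero_rpow (by linarith)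
  set D : E → E →L[ℝ] E := fun x =>
    axial (‖x‖⁻¹ • x) ((m - 1) * ‖x‖ ^ (m - 2)) (‖x‖ ^ (m - 2))
  have hD₀ : D 0 = 0 := by
    ext h
    simp [D, axial_apply, hzero]
  have hD : ∀ x, HasFDerivAt (fun x : E => ‖x‖ ^ (m - 2) • x) (D x) x := fun x => by
    obtain rfl | hx := eq_or_ne x 0
    · exact hD₀ ▸ hasFDerivAt_norm_rpow_smul_zero hm
    · exact hasFDerivAt_norm_rpow_smul m hx
  have hfderiv : fderiv ℝ (fun x : E => ‖x‖ ^ (m - 2) • x) = D := funext fun x => (hD x).fderiv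
  refine contDiff_one_iff_fderiv.2 ⟨fun x => (hD x).differentiableAt,
    continuous_iff_continuousAt.2 fun x => ?_⟩
  obtain rfl | hx := eq_or_ne x 0
  · rw [hfderiv, ContinuousAt, hD₀]
    have hbound : Continuous fun x : E => |‖x‖ ^ (m - 2)| +
        |(m - 1) * ‖x‖ ^ (m - 2) - ‖x‖ ^ (m - 2)| := by
      have := (continuous_norm (E := E)).rpow_const (p := m - 2) fun _ => Or.inr (by linarith)
      fun_prop
    refine squeeze_zero_norm (fun x => norm_axial_le (norm_inv_norm_smul_le_one x) _ _) ?_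
    simpa [hzero] using hbound.tendsto 0
  · have hsmooth : ContDiffAt ℝ 2 (fun x : E => ‖x‖ ^ (m - 2) • x) x :=
      ((contDiffAt_norm ℝ hx).rpow_const_of_ne (norm_ne_zero_iff.2 hx)).smul contDiffAt_id
    exact (hsmooth.fderiv_right (m := 1) (by norm_num)).continuousAt

theorem contDiff_two_norm_rpow (hm : 2 ≤ m) : ContDiff ℝ 2 (fun x : E => ‖x‖ ^ m) := by
  refine (contDiff_succ_iff_hasFDerivAt (n := 1)).2
    ⟨fun x => m • innerSL ℝ (‖x‖ ^ (m - 2) • x), ?_, fun x => ?_⟩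
  · exact ((innerSL ℝ).contDiff.comp (contDiff_norm_rpow_smul hm)).const_smul m
  · refine (hasFDerivAt_norm_rpow x (by linarith)).congr_fderiv ?_
    simp only [map_smul, smul_smul]

theorem contDiffAt_comp_norm_rpow {Y : ℝ → ℝ} (hY : ContDiff ℝ 2 Y) {x : E} (hx : x ≠ 0) :
    ContDiffAt ℝ 2 (fun x : E => Y (‖x‖ ^ m)) x :=
  hY.contDiffAt.comp x ((contDiffAt_norm ℝ hx).rpow_const_of_ne (norm_ne_zero_iff.2 hx))

end NormRpowRegularity

section RadialPower

variable {E : Type*} [NormedAddCommGroup E] [InnerProductSpace ℝ E] [CompleteSpace E]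
  {m : ℝ} {Y : ℝ → ℝ} {x : E}

theorem gradient_radial (hm : 1 < m) (hY : Differentiable ℝ Y) :
    ∇ (fun x : E => Y (‖x‖ ^ m)) = fun x => (m * deriv Y (‖x‖ ^ m)) • ‖x‖ ^ (m - 2) • x := by
  refine gradient_eq fun x => hasGradientAt_iff_hasFDerivAt.2 ?_
  refine ((hY _).hasDerivAt.comp_hasFDerivAt x (hasFDerivAt_norm_rpow x hm)).congr_fderiv ?_
  ext1 h
  simp only [smul_apply, innerSL_apply_apply, InnerProductSpace.toDual_apply_apply,
    real_inner_smul_left, smul_eq_mul]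
  ring

theorem gradient_radial_of_ne_zero (hm : 1 < m) (hY : Differentiable ℝ Y) (hx : x ≠ 0) :
    ∇ (fun x : E => Y (‖x‖ ^ m)) x =
      (m * ‖x‖ ^ (m - 1) * deriv Y (‖x‖ ^ m)) • ‖x‖⁻¹ • x := by
  have hx' := norm_ne_zero_iff.2 hx
  rw [congrFun (gradient_radial hm hY) x, smul_smul, smul_smul, show m - 1 = m - 2 + 1 by ring,
    Real.rpow_add_one hx']
  congr 1
  field_simp

theorem hasFDerivAt_gradient_radial (hm : 1 < m) (hY : ContDiff ℝ 2 Y) (hx : x ≠ 0) :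
    HasFDerivAt (∇ (fun x : E => Y (‖x‖ ^ m)))
      (axial (‖x‖⁻¹ • x)
        (m * (m - 1) * ‖x‖ ^ (m - 2) * deriv Y (‖x‖ ^ m) +
          m ^ 2 * ‖x‖ ^ (2 * m - 2) * deriv (deriv Y) (‖x‖ ^ m))
        (m * ‖x‖ ^ (m - 2) * deriv Y (‖x‖ ^ m))) x := by
  have hY₁ : Differentiable ℝ (deriv Y) :=
    ((contDiff_succ_iff_deriv (n := 1)).1 hY).2.2.differentiable one_ne_zero
  rw [gradient_radial hm (hY.differentiable two_ne_zero)]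
  refine ((((hY₁ _).hasDerivAt.comp_hasFDerivAt x (hasFDerivAt_norm_rpow x hm)).const_mul m).smul
    (hasFDerivAt_norm_rpow_smul m hx)).congr_fderiv ?_
  have hpow : ‖x‖ ^ (2 * m - 2) = ‖x‖ ^ (m - 2) * ‖x‖ ^ (m - 2) * (‖x‖ * ‖x‖) := by
    rw [← Real.rpow_add (norm_pos_iff.2 hx), ← sq, ← Real.rpow_two,
      ← Real.rpow_add (norm_pos_iff.2 hx)]
    ring_nf
  have := norm_ne_zero_iff.2 hx
  ext1 h
  simp only [add_apply, smul_apply, ContinuousLinearMap.smulRight_apply, innerSL_apply_apply,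
    axial_apply, real_inner_smul_left, smul_eq_mul, Function.comp_apply, smul_add, smul_smul]
  rw [add_assoc, ← add_smul, hpow]
  congr 2
  · ring
  · field_simp
    ring

end RadialPower

section RadialSubsolution

variable {n k : ℕ} {p α β : ℝ} {f : ℝ → ℝ}

theorem admissibleSubsolutionAt_of_axial (hk : 1 ≤ k) (hkn : k ≤ n) (hp : 1 < p) {u : Rn n → ℝ}
    {x ν : Rn n} {c e : ℝ} (hx : x ≠ 0) (hν : ‖ν‖ = 1) (hc : 0 < c) (hgrad : ∇ u x = c • ν)
    (hH : HasFDerivAt (∇ u) (axial ν e (c / ‖x‖)) x) (hf : 0 < f (u x))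
    (hineq : ‖x‖ ^ (n * (α + 1) / k - 1) * f (u x) ^ ((n : ℝ) / k) ≤
      (p - 1) * c ^ (n * (p - β - 1) / k - 1) * e) :
    AdmissibleSubsolutionAt n k p α β f u x := by
  have hr : 0 < ‖x‖ := norm_pos_iff.2 hx
  have hp₁ : 0 < p - 1 := by linarith
  have hk₁ : 0 ≤ (k : ℝ) - 1 := by rw [sub_nonneg]; exact_mod_cast hk
  have hkn' : (k : ℝ) ≤ n := by exact_mod_cast hkn
  have he : 0 < e := pos_of_mul_pos_right ((by positivity : (0 : ℝ) < _).trans_le hineq)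
    (by positivity)
  have hnorm : ‖∇ u x‖ = c := by rw [hgrad, norm_smul, hν, mul_one, Real.norm_of_nonneg hc.le]
  set κ := (p - 1) * e / c with hκ_def
  have : 0 < κ := by positivity
  have hpow : c ^ (p - 1) = c ^ (p - 2) * c := by rw [← Real.rpow_add_one hc.ne']; ring_nf
  have hV : HasFDerivAt (pGradField p u) (axial ν (c ^ (p - 1) * κ) (c ^ (p - 1) / ‖x‖)) x := by
    refine (hasFDerivAt_pGradField hH hν hc.ne' hgrad).congr_fderiv ?_
    rw [axial_comp_axial hν, abs_of_pos hc, hpow, hκ_def]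
    congr 1 <;> field_simp
  let j : Fin n := ⟨0, hk.trans hkn⟩
  refine ⟨hV.differentiableAt, fun _ => norm_ne_zero_iff.1 (hnorm ▸ hc.ne'),
    spike j (c ^ (p - 1) * κ) (c ^ (p - 1) / ‖x‖), ?_,
    spike_mem_coneP hk (by positivity) (by positivity), ?_⟩
  · rw [hV.fderiv]
    exact isEigenvalueTuple_axial hν j _ _
  rw [hnorm, weight_le_PiK_spike_iff hk hkn j hr hc hf (by positivity)]
  calc _ ≤ (p - 1) * c ^ (n * (p - β - 1) / k - 1) * e := hineq
    _ = 1 * (c ^ (n * (p - β - 1) / k) * (κ + 0)) := by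
      rw [Real.rpow_sub_one hc.ne', hκ_def]
      field_simp
      ring
    _ ≤ _ := by
      gcongr
      · exact Real.one_le_rpow (by linarith) (div_nonneg (by linarith) (by linarith))
      · positivity

theorem isEntireSubsolution_radial (hk : 1 ≤ k) (hkn : k ≤ n) (hp : 1 < p) (hf : ∀ t, 0 < f t)
    {m : ℝ} (hm : 1 < m) {Y : ℝ → ℝ} (hY : ContDiff ℝ 2 Y) (hpos : ∀ t, 0 < deriv Y t)
    (hineq : ∀ r, 0 < r → r ^ (n * (α + 1) / k - 1) * f (Y (r ^ m)) ^ ((n : ℝ) / k) ≤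
      (p - 1) * (m * r ^ (m - 1) * deriv Y (r ^ m)) ^ (n * (p - β - 1) / k - 1) *
        (m * (m - 1) * r ^ (m - 2) * deriv Y (r ^ m) +
          m ^ 2 * r ^ (2 * m - 2) * deriv (deriv Y) (r ^ m))) :
    IsEntireSubsolution n k p α β f (fun x : Rn n => Y (‖x‖ ^ m)) where
  contDiff_one := (hY.of_le one_le_two).comp (contDiff_norm_rpow hm)
  contDiffOn_two x hx := (contDiffAt_comp_norm_rpow hY hx).contDiffWithinAt
  nontrivial := by
    refine ⟨0, EuclideanSpace.single ⟨0, hk.trans hkn⟩ 1, ?_⟩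
    have hlt : Y 0 < Y 1 := strictMono_of_deriv_pos hpos one_pos
    simpa [Real.zero_rpow (by linarith : m ≠ 0)] using hlt.ne
  subsolution x hx := by
    have hr : 0 < ‖x‖ := norm_pos_iff.2 hx
    have := hpos (‖x‖ ^ m)
    refine admissibleSubsolutionAt_of_axial hk hkn hp hx (norm_smul_inv_norm (𝕜 := ℝ) hx)
      (by positivity) (gradient_radial_of_ne_zero hm (hY.differentiable two_ne_zero) hx) ?_ (hf _)
      (hineq _ hr)
    refine (hasFDerivAt_gradient_radial hm hY hx).congr_fderiv ?_
    rw [show m - 1 = m - 2 + 1 by ring, Real.rpow_add_one hr.ne']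
    congr 1
    field_simp

end RadialSubsolution

/-! ### Weak derivatives across a countable singular set -/

theorem integral_fderiv_single_eq_zero {n : ℕ} (i : Fin n) {g : (Fin n → ℝ) → ℝ}
    {s : Set (Fin n → ℝ)} (hs : s.Countable) (hg : Continuous g) (hgc : HasCompactSupport g)
    (hd : ∀ y ∉ s, DifferentiableAt ℝ g y)
    (hint : Integrable fun y => fderiv ℝ g y (Pi.single i 1)) :
    ∫ y, fderiv ℝ g y (Pi.single i 1) = 0 := by
  obtain ⟨l, rfl⟩ : ∃ l, n = l + 1 := Nat.exists_eq_succ_of_ne_zero (Fin.pos i).ne'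
  obtain ⟨R, hR, hgR⟩ := hgc.exists_pos_le_norm
  have hzero : ∀ y ∉ Icc (fun _ => -R) (fun _ => R), fderiv ℝ g y (Pi.single i 1) = 0 := by
    intro y hy
    have hRy : R < ‖y‖ := by
      by_contra! hle
      exact hy ⟨fun j => (abs_le.1 ((norm_le_pi_norm y j).trans hle)).1,
        fun j => (abs_le.1 ((norm_le_pi_norm y j).trans hle)).2⟩
    have hg₀ : g =ᶠ[𝓝 y] fun _ => 0 := by
      filter_upwards [continuous_norm.continuousAt.eventually (lt_mem_nhds hRy)] with z hz
      exact hgR z hz.le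
    rw [hg₀.fderiv_eq, fderiv_const_apply, zero_apply]
  have hsum : ∀ y, ∑ j, (Pi.single i (fderiv ℝ g y) : Fin (l + 1) → _) j (Pi.single j 1) =
      fderiv ℝ g y (Pi.single i 1) := fun y => by
    rw [Fintype.sum_eq_single i fun j hj => by simp [hj], Pi.single_eq_same]
  have hdiv := integral_divergence_of_hasFDerivAt_off_countable' (E := ℝ)
    (fun _ : Fin (l + 1) => -R) (fun _ => R) (fun _ => by dsimp only; linarith) (Pi.single i g)
    (fun j y => (Pi.single i (fderiv ℝ g y) : Fin (l + 1) → _) j) s hs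
    (fun j => by
      obtain rfl | hj := eq_or_ne j i
      · simpa using hg.continuousOn
      · simpa [hj] using! continuousOn_const)
    (fun y hy j => by
      obtain rfl | hj := eq_or_ne j i
      · simpa using (hd y hy.2).hasFDerivAt
      · simpa [hj] using! hasFDerivAt_const (0 : ℝ) y)
    (by simpa only [hsum] using hint.integrableOn)
  simp only [hsum] at hdiv
  rw [← setIntegral_eq_integral_of_forall_compl_eq_zero hzero, hdiv]
  refine Finset.sum_eq_zero fun j _ => ?_
  obtain rfl | hj := eq_or_ne j i
  · have hface : ∀ c, R ≤ |c| → ∀ y, g (j.insertNth c y) = 0 := fun c hc y => hgR _ <|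
      hc.trans (by simpa using norm_le_pi_norm (j.insertNth (α := fun _ => ℝ) c y) j)
    simp [hface R (le_abs_self R), hface (-R) (by rw [abs_neg]; exact le_abs_self R)]
  · simp [hj]

theorem integral_fderiv_euclideanSpace_single_eq_zero {n : ℕ} (i : Fin n) {g : Rn n → ℝ}
    {s : Set (Rn n)} (hs : s.Countable) (hg : Continuous g) (hgc : HasCompactSupport g)
    (hd : ∀ x ∉ s, DifferentiableAt ℝ g x)
    (hint : Integrable fun x => fderiv ℝ g x (EuclideanSpace.single i 1)) :
    ∫ x, fderiv ℝ g x (EuclideanSpace.single i 1) = 0 := by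
  let L := (EuclideanSpace.equiv (Fin n) ℝ).symm
  have hmp : MeasurePreserving L := PiLp.volume_preserving_toLp (Fin n)
  have hme : MeasurableEmbedding L := L.toHomeomorph.measurableEmbedding
  have hfderiv : ∀ y, fderiv ℝ (g ∘ L) y (Pi.single i 1) =
      fderiv ℝ g (L y) (EuclideanSpace.single i 1) := fun y => by
    rw [L.comp_right_fderiv]
    rfl
  rw [← hmp.integral_comp hme, ← integral_congr_ae (ae_of_all _ hfderiv)]
  refine integral_fderiv_single_eq_zero i (hs.preimage L.injective) (hg.comp L.continuous)
    (hgc.comp_homeomorph L.toHomeomorph) (fun y hy => (hd _ hy).comp y L.differentiableAt) ?_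
  simp only [hfderiv]
  exact (hmp.integrable_comp_emb hme).2 hint

theorem isWeakPartial_fderiv {n : ℕ} (i : Fin n) {w : Rn n → ℝ} {s : Set (Rn n)}
    (hs : s.Countable) (hw : Continuous w) (hd : ∀ x ∉ s, DifferentiableAt ℝ w x)
    (hint : LocallyIntegrable fun x => fderiv ℝ w x (EuclideanSpace.single i 1)) :
    IsWeakPartial i w fun x => fderiv ℝ w x (EuclideanSpace.single i 1) := by
  have : Nonempty (Fin n) := ⟨i⟩
  refine ⟨hw.locallyIntegrable, hint, fun φ hφ hφc => ?_⟩
  have hφd : Continuous fun x => fderiv ℝ φ x (EuclideanSpace.single i 1) :=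
    (hφ.continuous_fderiv (by simp)).clm_apply continuous_const
  have hint₁ : Integrable fun x => w x * fderiv ℝ φ x (EuclideanSpace.single i 1) :=
    (hw.mul hφd).integrable_of_hasCompactSupport (hφc.fderiv_apply ℝ _).mul_left
  have hint₂ : Integrable fun x => fderiv ℝ w x (EuclideanSpace.single i 1) * φ x := by
    simpa only [smul_eq_mul, mul_comm] using
      hint.integrable_smul_left_of_hasCompactSupport hφ.continuous hφc
  have hprod : (fun x => fderiv ℝ (fun y => w y * φ y) x (EuclideanSpace.single i 1)) =ᵐ[volume]
      fun x => w x * fderiv ℝ φ x (EuclideanSpace.single i 1) +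
        fderiv ℝ w x (EuclideanSpace.single i 1) * φ x := by
    filter_upwards [hs.ae_notMem volume] with x hx
    rw [fderiv_fun_mul (hd x hx) (hφ.differentiable (by simp) x)]
    simp [mul_comm]
  rw [eq_neg_iff_add_eq_zero, ← integral_add hint₁ hint₂, ← integral_congr_ae hprod]
  exact integral_fderiv_euclideanSpace_single_eq_zero i hs (hw.mul hφ.continuous) hφc.mul_left
    (fun x hx => (hd x hx).mul (hφ.differentiable (by simp) x))
    ((hint₁.add hint₂).congr hprod.symm)

/-! ### Sobolev regularity away from a point singularity -/

section Sobolev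

variable {n : ℕ} {δ σ : ℝ}

theorem LpLoc.of_continuous {h : Rn n → ℝ} (hc : Continuous h) : LpLoc δ h := by
  intro K hK
  have : IsFiniteMeasure (volume.restrict K) := ⟨by simpa using hK.measure_lt_top⟩
  obtain ⟨C, hC⟩ := hK.exists_bound_of_continuousOn hc.continuousOn
  exact MemLp.of_bound hc.aestronglyMeasurable C (ae_restrict_of_forall_mem hK.measurableSet hC)

theorem LpLoc.locallyIntegrable {h : Rn n → ℝ} (hh : LpLoc δ h) (hδ : 1 ≤ δ) :
    LocallyIntegrable h :=
  locallyIntegrable_iff.2 fun K hK =>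
    have : IsFiniteMeasure (volume.restrict K) := ⟨by simpa using hK.measure_lt_top⟩
    (hh K hK).integrable (ENNReal.one_le_ofReal.2 hδ)

theorem LpLoc.of_abs_le_mul_rpow (hn : 0 < n) (hδ : 0 < δ) (hσ : δ * σ < n) {b h : Rn n → ℝ}
    (hb : Continuous b) (hh : Measurable h) (hle : ∀ x ≠ 0, |h x| ≤ b x * ‖x‖ ^ (-σ)) :
    LpLoc δ h := by
  have : Nonempty (Fin n) := ⟨⟨0, hn⟩⟩
  intro K hK
  obtain ⟨C, hC⟩ := hK.exists_bound_of_continuousOn hb.continuousOn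
  rw [← integrable_norm_rpow_iff hh.aestronglyMeasurable (by simpa using hδ) (by simp),
    ENNReal.toReal_ofReal hδ.le]
  have hpow : LocallyIntegrable fun x : Rn n => C ^ δ * ‖x‖ ^ (-(δ * σ)) :=
    locallyIntegrable_of_norm_le_rpow (C := |C ^ δ|) (by simpa using! hn) (by simpa using hσ)
      (ae_of_all _ fun x => by
        rw [norm_mul, Real.norm_eq_abs, Real.norm_of_nonneg (by positivity : 0 ≤ ‖x‖ ^ (-(δ * σ)))])
      (Measurable.aestronglyMeasurable (by fun_prop))
  refine (hpow.integrableOn_isCompact hK).mono'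
    (hh.norm.pow_const δ).aestronglyMeasurable ?_
  filter_upwards [ae_restrict_of_ae (Measure.ae_ne volume 0), ae_restrict_mem hK.measurableSet]
    with x hx hxK
  have hC₀ : 0 ≤ C := (norm_nonneg _).trans (hC x hxK)
  have hhx : ‖h x‖ ≤ C * ‖x‖ ^ (-σ) :=
    (hle x hx).trans (by gcongr; exact (le_abs_self _).trans (hC x hxK))
  calc ‖‖h x‖ ^ δ‖ = ‖h x‖ ^ δ := Real.norm_of_nonneg (by positivity)
    _ ≤ (C * ‖x‖ ^ (-σ)) ^ δ := by gcongr
    _ = C ^ δ * ‖x‖ ^ (-(δ * σ)) := by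
      rw [Real.mul_rpow hC₀ (by positivity), ← Real.rpow_mul (norm_nonneg x)]
      ring_nf

theorem sobolevW2Loc_of_norm_hessian_le (hδ : 1 ≤ δ) (hσ : δ * σ < n)
    {u b : Rn n → ℝ} (hu : ContDiff ℝ 1 u) (hu₂ : ContDiffOn ℝ 2 u {0}ᶜ) (hb : Continuous b)
    (hle : ∀ x ≠ 0, ‖fderiv ℝ (∇ u) x‖ ≤ b x * ‖x‖ ^ (-σ)) : SobolevW2Loc δ u := by
  have hu₂' : ∀ x ≠ 0, ContDiffAt ℝ 2 u x := fun x hx =>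
    hu₂.contDiffAt (isOpen_compl_singleton.mem_nhds hx)
  set g : Fin n → Rn n → ℝ := fun i x => fderiv ℝ u x (EuclideanSpace.single i 1)
  have hg : ∀ i, Continuous (g i) := fun i =>
    (hu.continuous_fderiv one_ne_zero).clm_apply continuous_const
  have hgd : ∀ i, ∀ x ∉ ({0} : Set (Rn n)), DifferentiableAt ℝ (g i) x := fun i x hx =>
    (differentiableAt_fderiv (hu₂' x hx)).clm_apply (differentiableAt_const _)
  have hbound : ∀ i j, ∀ x ≠ 0,
      |fderiv ℝ (g i) x (EuclideanSpace.single j 1)| ≤ b x * ‖x‖ ^ (-σ) := fun i j x hx =>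
    calc |fderiv ℝ (g i) x (EuclideanSpace.single j 1)|
        = |⟪fderiv ℝ (∇ u) x (EuclideanSpace.single j 1), EuclideanSpace.single i (1 : ℝ)⟫| := by
          rw [inner_fderiv_gradient (hu₂' x hx), fderiv_clm_apply
            (differentiableAt_fderiv (hu₂' x hx)) (differentiableAt_const _)]
          simp
      _ ≤ ‖fderiv ℝ (∇ u) x (EuclideanSpace.single j 1)‖ := by
          simpa using abs_real_inner_le_norm (fderiv ℝ (∇ u) x (EuclideanSpace.single j 1))
            (EuclideanSpace.single i (1 : ℝ))
      _ ≤ ‖fderiv ℝ (∇ u) x‖ := by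
          simpa using (fderiv ℝ (∇ u) x).le_opNorm (EuclideanSpace.single j 1)
      _ ≤ _ := hle x hx
  have hLp : ∀ i j, LpLoc δ fun x => fderiv ℝ (g i) x (EuclideanSpace.single j 1) := fun i j =>
    LpLoc.of_abs_le_mul_rpow (Fin.pos i) (one_pos.trans_le hδ) hσ hb
      (measurable_fderiv_apply_const ℝ _ _) (hbound i j)
  refine ⟨.of_continuous hu.continuous, g, _, fun i => ⟨.of_continuous (hg i), ?_⟩,
    fun i j => ⟨hLp i j, ?_⟩⟩
  · exact isWeakPartial_fderiv i countable_empty hu.continuous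
      (fun x _ => hu.differentiable one_ne_zero x) (hg i).locallyIntegrable
  · exact isWeakPartial_fderiv j (countable_singleton 0) (hg i) (hgd i)
      ((hLp i j).locallyIntegrable hδ)

end Sobolev

/-! ### Existence of radial entire subsolutions -/

section Existence

variable {n k : ℕ} {p α β : ℝ} {f : ℝ → ℝ}

theorem sobolevW2Loc_radial {m δ : ℝ} {Y : ℝ → ℝ} (hm : 1 < m) (hY : ContDiff ℝ 2 Y)
    (hδ : 1 ≤ δ) (hδm : δ * (2 - m) < n) : SobolevW2Loc δ fun x : Rn n => Y (‖x‖ ^ m) := by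
  have hm₀ : Continuous fun x : Rn n => ‖x‖ ^ m :=
    (contDiff_norm_rpow hm).continuous
  have hY₁ : Continuous (deriv Y) := hY.continuous_deriv one_le_two
  have : Continuous (deriv (deriv Y)) :=
    ((contDiff_succ_iff_deriv (n := 1)).1 hY).2.2.continuous_deriv le_rfl
  set P : Rn n → ℝ := fun x => m * deriv Y (‖x‖ ^ m)
  set Q : Rn n → ℝ := fun x =>
    m * (m - 2) * deriv Y (‖x‖ ^ m) + m ^ 2 * ‖x‖ ^ m * deriv (deriv Y) (‖x‖ ^ m)
  refine sobolevW2Loc_of_norm_hessian_le (b := fun x => |P x| + |Q x|) (σ := 2 - m) hδ hδm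
    ((hY.of_le one_le_two).comp (contDiff_norm_rpow hm))
    (fun x hx => (contDiffAt_comp_norm_rpow hY hx).contDiffWithinAt) (by fun_prop) fun x hx => ?_
  have hr : 0 < ‖x‖ := norm_pos_iff.2 hx
  have hpow : ‖x‖ ^ (2 * m - 2) = ‖x‖ ^ m * ‖x‖ ^ (m - 2) := by
    rw [← Real.rpow_add hr]
    ring_nf
  rw [(hasFDerivAt_gradient_radial hm hY hx).fderiv]
  calc _ ≤ _ := norm_axial_le (norm_inv_norm_smul_le_one x) _ _
    _ = |P x * ‖x‖ ^ (m - 2)| + |Q x * ‖x‖ ^ (m - 2)| := by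
      rw [hpow]
      congr 2 <;> ring
    _ = (|P x| + |Q x|) * ‖x‖ ^ (-(2 - m)) := by
      rw [abs_mul (P x), abs_mul (Q x), abs_of_pos (Real.rpow_pos_of_pos hr (m - 2)), neg_sub,
        add_mul]

theorem exists_radial_isEntireSubsolution (hk : 1 ≤ k) (hkn : k ≤ n) (hp : 1 < p)
    (hα : -1 < α) (hβ : β < p - 1) (hf : ∀ t, 0 < f t) (hfm : Monotone f) (hfc : Continuous f)
    (hKO : KellerOsserman (fun s => f s ^ ((n : ℝ) / k)) (n * (p - β - 1) / k)) :
    ∃ Y, ContDiff ℝ 2 Y ∧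
      IsEntireSubsolution n k p α β f fun x => Y (‖x‖ ^ (1 + (α + 1) / (p - β - 1))) := by
  have : (0 : ℝ) < k := by exact_mod_cast hk
  have : (0 : ℝ) < n := by exact_mod_cast hk.trans hkn
  have hβ₀ : 0 < p - β - 1 := by linarith
  have hα₀ : 0 < α + 1 := by linarith
  have hm : 1 < 1 + (α + 1) / (p - β - 1) := lt_add_of_pos_right _ (by positivity)
  obtain ⟨Y, hY, hpos, hineq⟩ := exists_radial_profile (a := n * (α + 1) / k)
    (hfc.rpow_const fun s => Or.inl (hf s).ne') (fun s => Real.rpow_pos_of_pos (hf s) _)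
    (fun s t hst => Real.rpow_le_rpow (hf s).le (hfm hst) (by positivity)) hp (by positivity) hm
    (by field_simp; ring) hKO
  exact ⟨Y, hY, isEntireSubsolution_radial hk hkn hp hf hm hY hpos hineq⟩

theorem exists_isEntireSubsolution (hk : 1 ≤ k) (hkn : k ≤ n) (hp : 1 < p)
    (hα : -1 < α) (hβ : β < p - 1) (hf : ∀ t, 0 < f t) (hfm : Monotone f) (hfc : Continuous f)
    (hKO : KellerOsserman (fun s => f s ^ ((n : ℝ) / k)) (n * (p - β - 1) / k)) :
    ∃ u, IsEntireSubsolution n k p α β f u ∧ (p ≤ α + β + 2 → ContDiff ℝ 2 u) ∧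
      (α + β + 2 < p → ∀ δ, 1 ≤ δ → δ < n * ((p - β - 1) / (p - α - β - 2)) →
        SobolevW2Loc δ u) := by
  have hβ₀ : 0 < p - β - 1 := by linarith
  have hα₀ : 0 < α + 1 := by linarith
  obtain ⟨Y, hY, hu⟩ := exists_radial_isEntireSubsolution hk hkn hp hα hβ hf hfm hfc hKO
  refine ⟨_, hu, fun h => hY.comp (contDiff_two_norm_rpow ?_), fun h δ hδ hδm =>
    sobolevW2Loc_radial (lt_add_of_pos_right _ (by positivity)) hY hδ ?_⟩
  · have hexp : 1 ≤ (α + 1) / (p - β - 1) := (one_le_div hβ₀).2 (by linarith)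
    linarith
  · have hσ : 2 - (1 + (α + 1) / (p - β - 1)) = (p - α - β - 2) / (p - β - 1) := by
      field_simp
      ring
    rwa [hσ, ← lt_div_iff₀ (div_pos (by linarith) hβ₀), div_div_eq_mul_div, mul_div_assoc]

end Existence

theorem KellerOsserman.of_critical_exponent {f : ℝ → ℝ} (hf : ∀ t, 0 < f t) (hfc : Continuous f)
    {n k q ε a κ : ℝ} (hnk : 0 < n / k) (hq : 0 < q) (hε : ε < a) (ha : a ≤ 1)
    (hκ : κ = (1 - ε) / (a - ε))
    (h : KellerOsserman (fun s => f s ^ (κ * n / k)) (κ * n * q / k)) :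
    KellerOsserman (fun s => f s ^ (n / k)) (n * q / k) := by
  have hκ₁ : 1 ≤ κ := by
    rw [hκ, one_le_div (by linarith)]
    linarith
  refine .of_rpow (κ := κ) (hfc.rpow_const fun s => Or.inl (hf s).ne')
    (fun s => Real.rpow_pos_of_pos (hf s) _) hκ₁ (by rw [mul_div_right_comm]; positivity) ?_
  convert h using 1
  · ext s
    rw [← Real.rpow_mul (hf s).le]
    ring_nf
  · ring

end PiHessian

theorem theorem5p2_general (n k : ℕ) (hk : 1 ≤ k) (hkn : k ≤ n) (p α β : ℝ) (f : ℝ → ℝ)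
    (hf_pos : ∀ t, 0 < f t) (hf_mono : Monotone f) (hf_cont : Continuous f)
    (hα : -1 < α) (hβ : β < p - 1) (hp : 1 < p) :
    (PiHessian.KellerOsserman (fun s => f s ^ ((n : ℝ) / k)) (n * (p - β - 1) / k) →
      ∃ u : PiHessian.Rn n → ℝ,
        PiHessian.IsEntireSubsolution n k p α β f u ∧
        (p ≤ α + β + 2 → ContDiff ℝ 2 u) ∧
        (α + β + 2 < p →
          ∀ δ : ℝ, 1 ≤ δ → δ < n * ((p - β - 1) / (p - α - β - 2)) →
            PiHessian.SobolevW2Loc δ u)) ∧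
    (∀ u : PiHessian.Rn n → ℝ,
      PiHessian.IsEntireSubsolution n k p α β f u →
      PiHessian.KellerOsserman (fun s => f s ^ ((n : ℝ) / k)) (n * (p - β - 1) / k)) :=
  ⟨PiHessian.exists_isEntireSubsolution hk hkn hp hα hβ hf_pos hf_mono hf_cont,
    fun _ hu => hu.kellerOsserman hk hkn hα hp hβ hf_pos hf_mono hf_cont⟩

theorem theorem5p2 (n k : ℕ) (hk : 1 ≤ k) (hkn : k ≤ n) (p α β : ℝ) (f : ℝ → ℝ)
    (hf_pos : ∀ t, 0 < f t) (hf_mono : Monotone f) (hf_cont : Continuous f)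
    (hα : -1 < α) (hα' : α < (k : ℝ) / n - 1) (hβ : β < p - 1) (hp : 1 < p) :
    (∀ ε κ : ℝ, 0 < ε → ε < n * (α + 1) / k → κ = (1 - ε) / (n * (α + 1) / k - ε) →
      PiHessian.KellerOsserman (fun s => f s ^ (κ * n / k)) (κ * n * (p - β - 1) / k) →
      ∃ u : PiHessian.Rn n → ℝ,
        PiHessian.IsEntireSubsolution n k p α β f u ∧
        (p ≤ α + β + 2 → ContDiff ℝ 2 u) ∧
        (α + β + 2 < p → 0 ≤ (p - 1) * α + β →
          ∀ δ : ℝ, 1 < δ → δ < (p - β - 1) / (p - α - β - 2) →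
            PiHessian.SobolevW2Loc δ u)) ∧
    (∀ u : PiHessian.Rn n → ℝ,
      PiHessian.IsEntireSubsolution n k p α β f u →
      ((p ≤ α + β + 2 ∧ ContDiff ℝ 2 u) ∨
        (α + β + 2 < p ∧ 0 ≤ (p - 1) * α + β ∧
          ∃ δ : ℝ, 1 < δ ∧ δ < (p - β - 1) / (p - α - β - 2) ∧
            PiHessian.SobolevW2Loc δ u)) →
      PiHessian.KellerOsserman (fun s => f s ^ ((n : ℝ) / k)) (n * (p - β - 1) / k)) := by
  obtain ⟨hexists, hKO⟩ := theorem5p2_general n k hk hkn p α β f hf_pos hf_mono hf_cont hα hβ hp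
  refine ⟨fun ε κ _ hε hκ h => ?_, fun u hu _ => hKO u hu⟩
  have hk₀ : (0 : ℝ) < k := by exact_mod_cast hk
  have hn₁ : (1 : ℝ) ≤ n := by exact_mod_cast hk.trans hkn
  have ha : n * (α + 1) / k ≤ 1 :=
    (div_le_one hk₀).2 ((le_div_iff₀' (by linarith)).1 (by linarith))
  obtain ⟨u, hu, hC2, hW2⟩ := hexists
    (.of_critical_exponent hf_pos hf_cont (by positivity) (by linarith) hε ha hκ h)
  exact ⟨u, hu, hC2, fun hlt _ δ hδ hδ' => hW2 hlt δ hδ.le <| hδ'.trans_le <|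
    le_mul_of_one_le_left (div_nonneg (by linarith) (by linarith)) hn₁⟩
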